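/- **Corollary 5.** Let $n\ge 0$ and $k\ge 0$ be integers. For a multiindex $\alpha=(\alpha_{ij})_{1\le i,j\le n}$ of nonnegative integers write $|\alpha|=\sum_{i,j}\alpha_{ij}$, $\alpha!=\prod_{i,j}\alpha_{ij}!$ and, for a matrix $U$, $U^\alpha=\prod_{i,j}U_{ij}^{\alpha_{ij}}$. If $|\alpha|=kn$, let $c_\alpha$ be the coefficient of $X^\alpha$ in the polynomial $\det(X)^k$, where $X=(X_{ij})_{i,j=1}^n$ is the matrix of indeterminates. Then $$c_\alpha\,\alpha! = \frac{k!\,(k+1)!\cdots(k+n-1)!}{0!\,1!\cdots(n-1)!}\int_{\mathrm{SU}(n)}U^\alpha\,dU,$$ where $dU$ is the Haar measure on $\mathrm{SU}(n)$ of total mass $1$. Moreover, let $L(n)$ be the number of Latin squares of order $n$, i.e. of $n\times n$ matrices with entries in $\{1,\dots,n\}$ all of whose rows and columns are permutations of $\{1,\dots,n\}$. For such a square and a symbol $s$ let $\sigma_s$ be the permutation sending each row to the column in which $s$ stands in that row; the square is even or odd according to whether its sign $(-1)^{n(n-1)/2}\prod_{s=1}^n\operatorname{sign}(\sigma_s)$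 is $1$ or $-1$. Let $L^{\mathrm{even}}(n)$ and $L^{\mathrm{odd}}(n)$ be the numbers of even and odd Latin squares of order $n$. Then $$\left|L^{\mathrm{even}}(n)-L^{\mathrm{odd}}(n)\right|\le L(n)^{1/2}\left(\frac{4}{\sqrt e}\right)^{n^2(1+o(1))},$$ that is, there is a sequence of real numbers $\varepsilon_n\to 0$ such that $\left|L^{\mathrm{even}}(n)-L^{\mathrm{odd}}(n)\right|\le L(n)^{1/2}(4/\sqrt e)^{n^2(1+\varepsilon_n)}$ for all $n$. -/

import Mathlib

open MeasureTheory Filter Topology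
open scoped Nat

namespace LatinParity

/-- A Latin square of order `n`: an `n × n` matrix with entries in an `n`-element set of symbols
such that every row and every column is a permutation of the symbols. -/
def LatinSquare (n : ℕ) : Type :=
  {M : Matrix (Fin n) (Fin n) (Fin n) //
    (∀ i, Function.Bijective fun j => M i j) ∧ (∀ j, Function.Bijective fun i => M i j)}

instance (n : ℕ) : Fintype (LatinSquare n) :=
  inferInstanceAs (Fintype {M : Fin n → Fin n → Fin n //
    (∀ i, Function.Bijective fun j => M i j) ∧ (∀ j, Function.Bijective fun i => M i j)})

namespace LatinSquare

variable {n : ℕ}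

/-- The column in which the symbol `k` stands in row `i`. -/
noncomputable def position (S : LatinSquare n) (k i : Fin n) : Fin n :=
  (Equiv.ofBijective (fun j => S.1 i j) (S.2.1 i)).symm k

theorem entry_position (S : LatinSquare n) (k i : Fin n) : S.1 i (S.position k i) = k :=
  (Equiv.ofBijective (fun j => S.1 i j) (S.2.1 i)).apply_symm_apply k

theorem position_bijective (S : LatinSquare n) (k : Fin n) :
    Function.Bijective (S.position k) := by
  apply Finite.injective_iff_bijective.mp
  intro i i' h
  apply (S.2.2 (S.position k i)).1
  show S.1 i (S.position k i) = S.1 i' (S.position k i)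
  rw [S.entry_position, h, S.entry_position]

/-- The permutation `σ_k` of `{1, …, n}` whose permutation matrix marks the positions of the
symbol `k`. -/
noncomputable def symbolPerm (S : LatinSquare n) (k : Fin n) : Equiv.Perm (Fin n) :=
  Equiv.ofBijective (S.position k) (S.position_bijective k)

/-- The sign `(-1)^{n(n-1)/2} ∏ₖ sign(σ_k)` of a Latin square. -/
noncomputable def sign (S : LatinSquare n) : ℤˣ :=
  (-1) ^ (n * (n - 1) / 2) * ∏ k, Equiv.Perm.sign (S.symbolPerm k)

end LatinSquare

/-- `L(n)`, the number of Latin squares of order `n`. -/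
noncomputable def latinCount (n : ℕ) : ℕ := Nat.card (LatinSquare n)

/-- The number of even Latin squares of order `n`. -/
noncomputable def evenLatinCount (n : ℕ) : ℕ := Nat.card {S : LatinSquare n // S.sign = 1}

/-- The number of odd Latin squares of order `n`. -/
noncomputable def oddLatinCount (n : ℕ) : ℕ := Nat.card {S : LatinSquare n // S.sign = -1}

/-- The coefficient `c_α` of `X^α` in `det(X)^k`, for the generic matrix `X = (X_{ij})`. -/
noncomputable def detPowCoeff (n k : ℕ) (α : Fin n × Fin n →₀ ℕ) : ℤ :=
  MvPolynomial.coeff α ((Matrix.mvPolynomialX (Fin n) (Fin n) ℤ).det ^ k)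

/-- The special unitary group `SU(n)`, with the topology induced from the space of complex
matrices. -/
abbrev SU (n : ℕ) : Type := Matrix.specialUnitaryGroup (Fin n) ℂ

instance (n : ℕ) : IsTopologicalGroup (SU n) where
  continuous_inv := continuous_induced_rng.mpr
    (continuous_subtype_val.star : Continuous fun U : SU n => star (U : Matrix (Fin n) (Fin n) ℂ))

instance (n : ℕ) : CompactSpace (SU n) := by
  apply isCompact_iff_compactSpace.mp
  have hK : IsCompact (Set.univ.pi fun _ : Fin n => Set.univ.pi fun _ : Fin n =>
      Metric.closedBall (0 : ℂ) 1) :=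
    isCompact_univ_pi fun _ => isCompact_univ_pi fun _ => isCompact_closedBall _ _
  refine hK.of_isClosed_subset ?_ ?_
  · have h : ((Matrix.specialUnitaryGroup (Fin n) ℂ : Submonoid _) :
        Set (Matrix (Fin n) (Fin n) ℂ)) =
        (unitary (Matrix (Fin n) (Fin n) ℂ) : Set (Matrix (Fin n) (Fin n) ℂ)) ∩
          {A | A.det = 1} := by
      ext A
      exact Matrix.mem_specialUnitaryGroup_iff
    show IsClosed ((Matrix.specialUnitaryGroup (Fin n) ℂ : Submonoid _) :
        Set (Matrix (Fin n) (Fin n) ℂ))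
    rw [h]
    exact isClosed_unitary.inter (isClosed_eq continuous_id.matrix_det continuous_const)
  · intro A hA i _ j _
    rw [mem_closedBall_zero_iff]
    exact entry_norm_bound_of_unitary (Matrix.mem_specialUnitaryGroup_iff.mp hA).1 i j

noncomputable instance (n : ℕ) : MeasurableSpace (SU n) := borel (SU n)

instance (n : ℕ) : BorelSpace (SU n) := ⟨rfl⟩

/-- The normalized Haar measure `dU` on `SU(n)`: the Haar measure of total mass `1`. -/
noncomputable def haarSU (n : ℕ) : Measure (SU n) := Measure.haarMeasure ⊤

instance (n : ℕ) : (haarSU n).IsHaarMeasure :=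
  inferInstanceAs (Measure.haarMeasure (⊤ : TopologicalSpace.PositiveCompacts (SU n))).IsHaarMeasure

instance (n : ℕ) : IsProbabilityMeasure (haarSU n) :=
  ⟨Measure.haarMeasure_self (K₀ := (⊤ : TopologicalSpace.PositiveCompacts (SU n)))⟩

end LatinParity

/-! Put `T(A) = ∫ (∑ A_ij U_ij)^(kn) dU`, a polynomial in the entries of `A`. Haar invariance under
`SU(n)` and homogeneity give `T(A) = T(1) det(A)^k` for unitary `A`. The unitary group is Zariski
dense among all matrices (`mvPolynomial_eq_zero_of_eval_unitary`), so this is an identity of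
polynomials, and comparing coefficients of `A^α` shows that `∫ U^α` times a multinomial coefficient
is `T(1) c_α`.

The constant `T(1) = ∫ (tr U)^(kn)` is found by a Cayley-type recursion. The same density makes
integrals of homogeneous polynomials of degree `kn` relatively invariant under right translation by
every matrix `g`, with factor `det(g)^k`. Differentiating along elementary matrices turns `∫ det(U)
(tr U)^((k-1)n)` into an explicit multiple of `∫ (tr U)^(kn)`, one column at a time
(`signedTraceIntegral_step`). Since `det U = 1`, the exponents `k-1` and `k` are thereby linked
(`powTransform_one_mul`).

For Latin squares take `k = n` and `α` identically `1`: up to sign `c_α` is the difference of even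
and odd counts. The rows of `U` are unit vectors, so AM-GM bounds the integrand by `n^(-n²/2)`,
whence the difference is at most `R n^(-n²/2)` with `R = superRatio n`. Here `log R = n²(log n + 2
log 2 - 3/2)` up to `O(n log n)`, as an upper bound.

To bring in `L(n)^(1/2)` one needs `L(n) ≥ (n/e²)^(n²)` (`le_latinCount`). Latin rectangles are
extended row by row; the number of extensions is the permanent of a regular 0-1 matrix, bounded
below by `exp_neg_le_permanent`. That bound follows Gurvits: for stable polynomials each partial
derivative costs at most a factor `e` in capacity (`IsPosStable.capacity_pderiv`). Combining the
estimates leaves `2 log 2 - 1/2 = log (4/√e)` per `n²`. -/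

namespace LatinParity

/-! ### Zariski density of the unitary group. -/

section Density

variable {ι : Type*} [Fintype ι] [DecidableEq ι]

open ComplexOrder in
/-- Every invertible complex matrix is `W * diagonal d * V` with `W`, `V` unitary. -/
theorem exists_unitary_mul_diagonal_mul_unitary (X : Matrix ι ι ℂ) (hX : X.det ≠ 0) :
    ∃ W ∈ Matrix.unitaryGroup ι ℂ, ∃ V ∈ Matrix.unitaryGroup ι ℂ, ∃ d : ι → ℂ,
      X = W * Matrix.diagonal d * V := by
  have hu : IsUnit X := (Matrix.isUnit_iff_isUnit_det X).mpr (isUnit_iff_ne_zero.mpr hX)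
  have hpd : (X.conjTranspose * X).PosDef :=
    Matrix.PosDef.conjTranspose_mul_self X (Matrix.mulVec_injective_iff_isUnit.mpr hu)
  have hH := hpd.isHermitian
  set V := hH.eigenvectorUnitary with hV
  have hlam : ∀ i, 0 < hH.eigenvalues i := hpd.eigenvalues_pos
  have hspec := hH.spectral_theorem
  rw [Unitary.conjStarAlgAut_apply] at hspec
  have hVV : star (V : Matrix ι ι ℂ) * V = 1 := Unitary.coe_star_mul_self V
  have hVV' : (V : Matrix ι ι ℂ) * star (V : Matrix ι ι ℂ) = 1 := Unitary.coe_mul_star_self V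
  set D : Matrix ι ι ℂ := Matrix.diagonal fun i => ((√(hH.eigenvalues i) : ℝ) : ℂ)
  set E : Matrix ι ι ℂ := Matrix.diagonal fun i => (((√(hH.eigenvalues i))⁻¹ : ℝ) : ℂ)
  have hED : E * D = 1 := by
    rw [Matrix.diagonal_mul_diagonal, ← Matrix.diagonal_one]
    congr 1; ext i
    rw [← Complex.ofReal_mul, inv_mul_cancel₀ (Real.sqrt_pos.mpr (hlam i)).ne', Complex.ofReal_one]
  have hE : star E = E := by
    rw [Matrix.star_eq_conjTranspose, Matrix.diagonal_conjTranspose]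
    congr 1; ext i; simp
  have hEE : E * (Matrix.diagonal (RCLike.ofReal ∘ hH.eigenvalues)) * E = 1 := by
    rw [Matrix.diagonal_mul_diagonal, Matrix.diagonal_mul_diagonal, ← Matrix.diagonal_one]
    congr 1; ext i
    have h := (Real.sqrt_pos.mpr (hlam i)).ne'
    have h2 := Real.mul_self_sqrt (hlam i).le
    simp only [Function.comp]
    show (((√(hH.eigenvalues i))⁻¹ : ℝ) : ℂ) * ((hH.eigenvalues i : ℝ) : ℂ) *
      (((√(hH.eigenvalues i))⁻¹ : ℝ) : ℂ) = 1
    norm_cast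
    field_simp
    rw [sq, h2]
  -- With `X* X = V Λ V*`, the matrix `X V Λ^(-1/2)` is unitary; this is the singular value
  -- decomposition.
  refine ⟨X * V * E, ?_, star (V : Matrix ι ι ℂ), ?_, fun i => ((√(hH.eigenvalues i) : ℝ) : ℂ), ?_⟩
  · rw [Matrix.mem_unitaryGroup_iff']
    have : star (X * V * E) * (X * V * E) = E * (star (V : Matrix ι ι ℂ) *
        (X.conjTranspose * X) * V) * E := by
      rw [star_mul, star_mul, hE, Matrix.star_eq_conjTranspose X]
      simp only [Matrix.mul_assoc]
    rw [this, hspec]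
    calc _ = E * ((star (V : Matrix ι ι ℂ) * (V : Matrix ι ι ℂ)) *
          Matrix.diagonal (RCLike.ofReal ∘ hH.eigenvalues) *
          (star (V : Matrix ι ι ℂ) * (V : Matrix ι ι ℂ))) * E := by simp only [Matrix.mul_assoc]; rfl
      _ = 1 := by rw [hVV, one_mul, mul_one, hEE]
  · exact (star V).2
  · show X = X * V * E * D * star (V : Matrix ι ι ℂ)
    rw [mul_assoc (X * V.1), hED, mul_one, mul_assoc, hVV', mul_one]

open MvPolynomial in
/-- The unitary group is Zariski dense in the space of matrices. -/
theorem mvPolynomial_eq_zero_of_eval_unitary (p : MvPolynomial (ι × ι) ℂ)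
    (h : ∀ U ∈ Matrix.unitaryGroup ι ℂ, eval (fun ij => U ij.1 ij.2) p = 0) : p = 0 := by
  have key : ∀ X : Matrix ι ι ℂ, X.det ≠ 0 → eval (fun ij => X ij.1 ij.2) p = 0 := by
    intro X hX
    obtain ⟨W, hW, V, hV, d, rfl⟩ := exists_unitary_mul_diagonal_mul_unitary X hX
    set q : MvPolynomial ι ℂ :=
      bind₁ (fun ij : ι × ι => ∑ l, C (W ij.1 l) * X l * C (V l ij.2)) p with hq
    have hqe : ∀ e : ι → ℂ, eval e q =
        eval (fun ij => (W * Matrix.diagonal e * V) ij.1 ij.2) p := by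
      intro e
      show aeval e q = aeval (fun ij => (W * Matrix.diagonal e * V) ij.1 ij.2) p
      rw [hq, aeval_bind₁]
      congr 2
      ext ij
      simp [Matrix.mul_apply, Matrix.diagonal_apply]
    -- For `d` on the torus `|d_i| = 1` the matrix `W diag(d) V` is unitary, so `q` vanishes on a
    -- product of infinite sets.
    have hq0 : q = 0 := by
      refine funext_set (fun _ => {z : ℂ | ‖z‖ = 1}) (fun _ => ?_) ?_
      · have h1 := (isPreconnected_sphere (E := ℂ) (by rw [Complex.rank_real_complex]; norm_num)
          0 1).infinite_of_nontrivial ⟨1, by simp, -1, by simp, by norm_num⟩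
        convert h1 using 1
        ext z; simp
      · intro x hx
        rw [hqe, map_zero]
        apply h
        refine mul_mem (mul_mem hW ?_) hV
        rw [Matrix.mem_unitaryGroup_iff, Matrix.star_eq_conjTranspose,
          Matrix.diagonal_conjTranspose, Matrix.diagonal_mul_diagonal, ← Matrix.diagonal_one]
        congr 1; ext i
        have : ‖x i‖ = 1 := hx i trivial
        show x i * star (x i) = 1
        rw [Complex.star_def, Complex.mul_conj, Complex.normSq_eq_norm_sq, this]; simp
    rw [← hqe, hq0, map_zero]
  have hdet : ∀ x : ι × ι → ℂ, eval x (Matrix.mvPolynomialX ι ι ℂ).det =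
      (Matrix.of fun i j => x (i, j)).det := by
    intro x
    rw [RingHom.map_det]; congr 1; ext i j; simp [Matrix.mvPolynomialX]
  -- Multiplying by the determinant disposes of singular matrices; the determinant is a nonzero
  -- polynomial and can be cancelled.
  have h2 : p * (Matrix.mvPolynomialX ι ι ℂ).det = 0 := by
    apply MvPolynomial.funext
    intro x
    rw [map_mul, map_zero]
    rw [hdet]
    by_cases hx : (Matrix.of fun i j => x (i, j)).det = 0
    · rw [hx, mul_zero]
    · rw [show eval x p = 0 from key (Matrix.of fun i j => x (i, j)) hx, zero_mul]
  rcases mul_eq_zero.mp h2 with h3 | h3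
  · exact h3
  · have h4 := congrArg (eval fun ij : ι × ι => (1 : Matrix ι ι ℂ) ij.1 ij.2) h3
    rw [hdet, map_zero] at h4
    have h5 : (1 : Matrix ι ι ℂ).det = 0 := h4
    rw [Matrix.det_one] at h5
    exact absurd h5 one_ne_zero

end Density

/-! ### Moments as coefficients of a generating polynomial. -/

section Moments

open MvPolynomial

variable {Ω ι : Type*} [TopologicalSpace Ω] [CompactSpace Ω] [MeasurableSpace Ω] [BorelSpace Ω]
  (μ : Measure Ω) [IsFiniteMeasure μ] [Fintype ι] [DecidableEq ι]

theorem integrable_of_continuous {f : Ω → ℂ} (hf : Continuous f) : Integrable f μ :=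
  hf.integrable_of_hasCompactSupport (HasCompactSupport.of_compactSpace f)

/-- The polynomial `a ↦ ∫ (∑ aᵢ wᵢ) ^ N`. -/
noncomputable def momentPoly (w : Ω → ι → ℂ) (N : ℕ) : MvPolynomial ι ℂ :=
  ∑ α ∈ Finset.piAntidiag Finset.univ N, monomial (Finsupp.equivFunOnFinite.symm α)
    (Nat.multinomial Finset.univ α * ∫ x, ∏ i, w x i ^ α i ∂μ)

theorem eval_momentPoly {w : Ω → ι → ℂ} (hw : Continuous w) (N : ℕ) (a : ι → ℂ) :
    eval a (momentPoly μ w N) = ∫ x, (∑ i, a i * w x i) ^ N ∂μ := by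
  have hwi : ∀ i, Continuous fun x => w x i := fun i => (continuous_apply i).comp hw
  simp_rw [Finset.sum_pow_eq_sum_piAntidiag]
  rw [integral_finsetSum, momentPoly, map_sum]
  · refine Finset.sum_congr rfl fun α _ => ?_
    rw [eval_monomial, integral_const_mul]
    simp_rw [mul_pow, Finset.prod_mul_distrib]
    rw [integral_const_mul, Finsupp.prod_fintype _ _ (fun i => pow_zero _)]
    simp only [Finsupp.equivFunOnFinite_symm_apply_apply]
    ring
  · intro α _
    exact integrable_of_continuous μ (by fun_prop)

omit [TopologicalSpace Ω] [CompactSpace Ω] [BorelSpace Ω] [IsFiniteMeasure μ] in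
theorem coeff_momentPoly (w : Ω → ι → ℂ) {N : ℕ} (α : ι →₀ ℕ) (hα : ∑ i, α i = N) :
    coeff α (momentPoly μ w N) =
      Nat.multinomial Finset.univ α * ∫ x, ∏ i, w x i ^ α i ∂μ := by
  rw [momentPoly, coeff_sum, Finset.sum_eq_single (α : ι → ℕ)]
  · rw [coeff_monomial, if_pos (by ext; simp)]
  · intro β _ hβ
    rw [coeff_monomial, if_neg]
    rintro rfl
    exact hβ (by ext; simp)
  · intro h
    exact absurd (by simp [Finset.mem_piAntidiag, hα]) h

end Moments

/-! ### The transform of Haar measure is a multiple of `det^k`. -/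

section Invariance

variable {n : ℕ}

/-- The transform `A ↦ ∫ (∑ Aᵢⱼ Uᵢⱼ) ^ N dU`. -/
noncomputable def powTransform (N : ℕ) (A : Matrix (Fin n) (Fin n) ℂ) : ℂ :=
  ∫ U : SU n, (∑ ij : Fin n × Fin n, A ij.1 ij.2 * U.1 ij.1 ij.2) ^ N ∂haarSU n

theorem sum_mul_eq_trace (A B : Matrix (Fin n) (Fin n) ℂ) :
    ∑ ij : Fin n × Fin n, A ij.1 ij.2 * B ij.1 ij.2 = (A.transpose * B).trace := by
  rw [Fintype.sum_prod_type, Finset.sum_comm]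
  simp [Matrix.trace, Matrix.mul_apply]

theorem powTransform_transpose_mul (N : ℕ) (V : SU n) (A : Matrix (Fin n) (Fin n) ℂ) :
    powTransform N (V.1.transpose * A) = powTransform N A := by
  unfold powTransform
  rw [← integral_mul_left_eq_self
    (fun U : SU n => (∑ ij : Fin n × Fin n, A ij.1 ij.2 * U.1 ij.1 ij.2) ^ N) V]
  refine integral_congr_ae (Eventually.of_forall fun U => ?_)
  simp only [sum_mul_eq_trace, Submonoid.coe_mul, Matrix.transpose_mul, Matrix.transpose_transpose,
    Matrix.mul_assoc]

theorem powTransform_smul (N : ℕ) (t : ℂ) (A : Matrix (Fin n) (Fin n) ℂ) :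
    powTransform N (t • A) = t ^ N * powTransform N A := by
  unfold powTransform
  rw [← integral_const_mul]
  simp only [Matrix.smul_apply, smul_eq_mul, mul_assoc, ← Finset.mul_sum, mul_pow]

/-- Write `A = t W` with `t` an `n`-th root of `det A`, so that `W` has determinant `1`. Invariance
removes `W`, and homogeneity gives `t^(kn) = det(A)^k`. -/
theorem powTransform_unitary (k : ℕ) (A : Matrix (Fin n) (Fin n) ℂ)
    (hA : A ∈ Matrix.unitaryGroup (Fin n) ℂ) :
    powTransform (k * n) A = powTransform (k * n) (1 : Matrix (Fin n) (Fin n) ℂ) * A.det ^ k := by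
  rcases Nat.eq_zero_or_pos n with rfl | hn
  · rw [Subsingleton.elim A 1]; simp
  obtain ⟨t, ht⟩ := IsAlgClosed.exists_pow_nat_eq A.det hn
  have hdet : ‖A.det‖ = 1 :=
    (Matrix.det_of_mem_unitary hA).1 |> fun h => by
      have h2 := congrArg norm h
      rw [norm_mul, norm_star, norm_one] at h2
      nlinarith [norm_nonneg A.det]
  have htn : ‖t‖ = 1 := by
    have h2 : ‖t‖ ^ n = 1 := by rw [← norm_pow, ht, hdet]
    exact (pow_eq_one_iff_of_nonneg (norm_nonneg t) hn.ne').mp h2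
  have ht0 : t ≠ 0 := by rintro rfl; simp at htn
  have hts : star t * t = 1 := by
    rw [Complex.star_def, mul_comm, Complex.mul_conj, Complex.normSq_eq_norm_sq, htn]; simp
  set W : Matrix (Fin n) (Fin n) ℂ := t⁻¹ • A with hW
  have hAW : A = t • W := by rw [hW, smul_smul, mul_inv_cancel₀ ht0, one_smul]
  have hWu : W ∈ Matrix.unitaryGroup (Fin n) ℂ := by
    rw [Matrix.mem_unitaryGroup_iff] at hA ⊢
    have h3 : star t⁻¹ * t⁻¹ = 1 := by rw [star_inv₀, ← mul_inv, hts, inv_one]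
    rw [hW, star_smul, Matrix.smul_mul, Matrix.mul_smul, smul_smul, mul_comm, h3, one_smul, hA]
  have hWd : W.det = 1 := by
    rw [hW, Matrix.det_smul, Fintype.card_fin, inv_pow, ht, inv_mul_cancel₀]
    rw [← norm_ne_zero_iff, hdet]; exact one_ne_zero
  have hWt : W.transpose ∈ Matrix.specialUnitaryGroup (Fin n) ℂ := by
    rw [Matrix.mem_specialUnitaryGroup_iff]
    refine ⟨?_, by rw [Matrix.det_transpose, hWd]⟩
    rw [Matrix.mem_unitaryGroup_iff'] at hWu
    rw [Matrix.mem_unitaryGroup_iff]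
    have := congrArg Matrix.transpose hWu
    rw [Matrix.transpose_mul, Matrix.transpose_one] at this
    exact this
  have h := powTransform_transpose_mul (k * n) ⟨W.transpose, hWt⟩ 1
  rw [Matrix.transpose_transpose, mul_one] at h
  rw [hAW, powTransform_smul, h, Matrix.det_smul, hWd, Fintype.card_fin, mul_one, ← pow_mul,
    mul_comm n k, mul_comm]

theorem continuous_entries : Continuous fun (U : SU n) (ij : Fin n × Fin n) => U.1 ij.1 ij.2 :=
  continuous_pi fun ij => continuous_subtype_val.matrix_elem ij.1 ij.2

open MvPolynomial in
-- Both sides are polynomials in `A` that agree on unitary `A`, hence are equal by density.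
theorem momentPoly_haarSU (k : ℕ) :
    momentPoly (haarSU n) (fun (U : SU n) (ij : Fin n × Fin n) => U.1 ij.1 ij.2) (k * n) =
      C (powTransform (k * n) (1 : Matrix (Fin n) (Fin n) ℂ)) *
        (Matrix.mvPolynomialX (Fin n) (Fin n) ℂ).det ^ k := by
  rw [← sub_eq_zero]
  apply mvPolynomial_eq_zero_of_eval_unitary
  intro U hU
  rw [map_sub, eval_momentPoly _ continuous_entries, map_mul, eval_C, map_pow,
    Matrix.eval_det_mvPolynomialX, sub_eq_zero]
  exact powTransform_unitary k U hU

theorem powTransform_eq (k : ℕ) (A : Matrix (Fin n) (Fin n) ℂ) :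
    powTransform (k * n) A =
      powTransform (k * n) (1 : Matrix (Fin n) (Fin n) ℂ) * A.det ^ k := by
  have h := congrArg (MvPolynomial.eval fun ij : Fin n × Fin n => A ij.1 ij.2)
    (momentPoly_haarSU (n := n) k)
  rw [eval_momentPoly _ continuous_entries, map_mul, MvPolynomial.eval_C, map_pow,
    Matrix.eval_det_mvPolynomialX] at h
  exact h

theorem detPowCoeff_cast (k : ℕ) (α : Fin n × Fin n →₀ ℕ) :
    (detPowCoeff n k α : ℂ) =
      MvPolynomial.coeff α ((Matrix.mvPolynomialX (Fin n) (Fin n) ℂ).det ^ k) := by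
  have : (Matrix.mvPolynomialX (Fin n) (Fin n) ℂ).det ^ k =
      MvPolynomial.map (Int.castRingHom ℂ) ((Matrix.mvPolynomialX (Fin n) (Fin n) ℤ).det ^ k) := by
    rw [map_pow, RingHom.map_det]
    congr 2
    ext1 i j
    simp [Matrix.mvPolynomialX]
  rw [this, MvPolynomial.coeff_map]
  rfl

theorem multinomial_mul_integral (k : ℕ) (α : Fin n × Fin n →₀ ℕ) (hα : ∑ ij, α ij = k * n) :
    Nat.multinomial Finset.univ α * ∫ U : SU n, ∏ ij, U.1 ij.1 ij.2 ^ α ij ∂haarSU n =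
      powTransform (k * n) (1 : Matrix (Fin n) (Fin n) ℂ) * detPowCoeff n k α := by
  rw [← coeff_momentPoly (haarSU n)
    (fun (U : SU n) (ij : Fin n × Fin n) => U.1 ij.1 ij.2) α hα, momentPoly_haarSU,
    MvPolynomial.coeff_C_mul, detPowCoeff_cast]

/-- Monomial integrals are relatively invariant under right translation by all matrices. -/
theorem integral_monomial_mul_right (k : ℕ) (α : Fin n × Fin n →₀ ℕ) (hα : ∑ ij, α ij = k * n)
    (g : Matrix (Fin n) (Fin n) ℂ) :
    ∫ U : SU n, ∏ ij, (U.1 * g) ij.1 ij.2 ^ α ij ∂haarSU n =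
      g.det ^ k * ∫ U : SU n, ∏ ij, U.1 ij.1 ij.2 ^ α ij ∂haarSU n := by
  have hc : Continuous fun (U : SU n) (ij : Fin n × Fin n) => (U.1 * g) ij.1 ij.2 :=
    continuous_pi fun ij =>
      (continuous_subtype_val.matrix_mul continuous_const).matrix_elem ij.1 ij.2
  have h : momentPoly (haarSU n) (fun (U : SU n) (ij : Fin n × Fin n) => (U.1 * g) ij.1 ij.2)
      (k * n) = MvPolynomial.C (g.det ^ k) *
        momentPoly (haarSU n) (fun (U : SU n) (ij : Fin n × Fin n) => U.1 ij.1 ij.2) (k * n) := by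
    apply MvPolynomial.funext
    intro x
    rw [eval_momentPoly _ hc, map_mul, MvPolynomial.eval_C, eval_momentPoly _ continuous_entries]
    set A : Matrix (Fin n) (Fin n) ℂ := Matrix.of fun i j => x (i, j) with hA
    -- Since `tr(Aᵀ U g) = tr((A gᵀ)ᵀ U)`, translating `U` on the right by `g` replaces `A` by `A
    -- gᵀ` in the transform, and `det` is multiplicative.
    have h1 : ∀ U : SU n, ∑ ij, x ij * (U.1 * g) ij.1 ij.2 =
        ∑ ij : Fin n × Fin n, (A * g.transpose) ij.1 ij.2 * U.1 ij.1 ij.2 := by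
      intro U
      rw [sum_mul_eq_trace, Matrix.transpose_mul, Matrix.transpose_transpose, Matrix.mul_assoc,
        Matrix.trace_mul_comm, Matrix.mul_assoc, ← sum_mul_eq_trace]
      rfl
    simp_rw [h1]
    have h2 := powTransform_eq k (A * g.transpose)
    rw [Matrix.det_mul, Matrix.det_transpose, mul_pow, ← mul_assoc, ← powTransform_eq,
      mul_comm (powTransform _ A)] at h2
    exact h2
  have h3 := congrArg (MvPolynomial.coeff α) h
  rw [MvPolynomial.coeff_C_mul, coeff_momentPoly _ _ α hα, coeff_momentPoly _ _ α hα,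
    mul_left_comm] at h3
  exact mul_left_cancel₀ (Nat.cast_ne_zero.mpr (Nat.multinomial_pos _ _).ne') h3

end Invariance

/-! ### Differentiation under the integral sign. -/

section Parametric

variable {Ω : Type*} [TopologicalSpace Ω] [CompactSpace Ω] [MeasurableSpace Ω] [BorelSpace Ω]
  (μ : Measure Ω) [IsFiniteMeasure μ]

theorem hasDerivAt_integral_of_compactSpace {h h' : ℂ → Ω → ℂ}
    (hc : ∀ t, Continuous (h t)) (hd : ∀ t x, HasDerivAt (fun s => h s x) (h' t x) t)
    (hc' : Continuous (Function.uncurry h')) :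
    HasDerivAt (fun t => ∫ x, h t x ∂μ) (∫ x, h' 0 x ∂μ) 0 := by
  obtain ⟨C, hC⟩ := ((isCompact_closedBall (0 : ℂ) 1).prod
    (isCompact_univ (X := Ω))).exists_bound_of_continuousOn hc'.continuousOn
  refine (hasDerivAt_integral_of_dominated_loc_of_deriv_le (bound := fun _ => C)
    (Metric.ball_mem_nhds (0 : ℂ) one_pos)
    (Eventually.of_forall fun t => (integrable_of_continuous μ (hc t)).aestronglyMeasurable)
    (integrable_of_continuous μ (hc 0)) ?_ (Eventually.of_forall fun x t ht => ?_)
    (integrable_const C) (Eventually.of_forall fun x t _ => hd t x)).2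
  · exact (integrable_of_continuous μ
      (hc'.comp (by fun_prop : Continuous fun x => ((0 : ℂ), x)))).aestronglyMeasurable
  · exact hC (t, x) ⟨Metric.ball_subset_closedBall ht, trivial⟩

/-- The product rule at `t = 0`, packaged for the recursion: `q` and `b` are the velocities of the
product of entries and of the trace. -/
theorem integral_deriv_mul_pow {p q a b : Ω → ℂ} (hp : Continuous p) (hq : Continuous q)
    (ha : Continuous a) (hb : Continuous b) (M : ℕ) {F : ℂ → ℂ} {F' : ℂ} (hF : HasDerivAt F F' 0)
    (h : ∀ t, ∫ x, (p x + t * q x) * (a x + t * b x) ^ (M + 1) ∂μ = F t) :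
    ∫ x, q x * a x ^ (M + 1) ∂μ + (M + 1) * ∫ x, p x * a x ^ M * b x ∂μ = F' := by
  have h1 : ∀ t x, HasDerivAt (fun s : ℂ => (p x + s * q x) * (a x + s * b x) ^ (M + 1))
      (q x * (a x + t * b x) ^ (M + 1) + (p x + t * q x) *
        ((M + 1) * (a x + t * b x) ^ M * b x)) t := by
    intro t x
    have e1 : HasDerivAt (fun s : ℂ => a x + s * b x) (b x) t := by
      simpa using ((hasDerivAt_id t).mul_const (b x)).const_add (a x)
    have e2 : HasDerivAt (fun s : ℂ => p x + s * q x) (q x) t := by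
      simpa using ((hasDerivAt_id t).mul_const (q x)).const_add (p x)
    have e3 := e2.fun_mul (e1.fun_pow (M + 1))
    simpa using e3
  have h2 := hasDerivAt_integral_of_compactSpace μ (fun t => by fun_prop) h1
    (by unfold Function.uncurry; fun_prop)
  simp_rw [h] at h2
  rw [hF.unique h2, ← integral_const_mul, ← integral_add]
  · congr 1; ext x; ring
  · exact integrable_of_continuous μ (by fun_prop)
  · exact integrable_of_continuous μ (by fun_prop)

end Parametric

/-! ### Evaluation of the trace moments. -/

section Recursion

variable {n : ℕ}

open MvPolynomial in
theorem integral_eval_mul_right (k : ℕ) {f : MvPolynomial (Fin n × Fin n) ℂ}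
    (hf : f.IsHomogeneous (k * n)) (g : Matrix (Fin n) (Fin n) ℂ) :
    ∫ U : SU n, eval (fun ij => (U.1 * g) ij.1 ij.2) f ∂haarSU n =
      g.det ^ k * ∫ U : SU n, eval (fun ij => U.1 ij.1 ij.2) f ∂haarSU n := by
  have hc : ∀ ij : Fin n × Fin n, Continuous fun U : SU n => (U.1 * g) ij.1 ij.2 := fun ij =>
    (continuous_subtype_val.matrix_mul continuous_const).matrix_elem ij.1 ij.2
  have hc' : ∀ ij : Fin n × Fin n, Continuous fun U : SU n => U.1 ij.1 ij.2 := fun ij =>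
    continuous_subtype_val.matrix_elem ij.1 ij.2
  simp_rw [eval_eq']
  rw [integral_finsetSum, integral_finsetSum, Finset.mul_sum]
  · refine Finset.sum_congr rfl fun α hα => ?_
    rw [integral_const_mul, integral_const_mul, integral_monomial_mul_right k α _ g]
    · ring
    · have := hf (mem_support_iff.mp hα)
      rw [Finsupp.weight_apply, Finsupp.sum_fintype _ _ (by simp)] at this
      simpa using this
  · intro α _
    exact integrable_of_continuous _
      (continuous_const.mul (continuous_finsetProd _ fun ij _ => (hc' ij).pow _))
  · intro α _
    exact integrable_of_continuous _
      (continuous_const.mul (continuous_finsetProd _ fun ij _ => (hc ij).pow _))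

/-- The integral of `∏_{j ∈ S} U_{σ(j) j} · (tr U) ^ M`. -/
noncomputable def permTraceIntegral (S : Finset (Fin n)) (σ : Equiv.Perm (Fin n)) (M : ℕ) : ℂ :=
  ∫ U : SU n, (∏ j ∈ S, U.1 (σ j) j) * U.1.trace ^ M ∂haarSU n

theorem det_one_add_single (i m : Fin n) (t : ℂ) :
    (1 + Matrix.single m i t : Matrix (Fin n) (Fin n) ℂ).det = if m = i then 1 + t else 1 := by
  split_ifs with h
  · subst h
    have : (1 + Matrix.single m m t : Matrix (Fin n) (Fin n) ℂ) =
        Matrix.diagonal (Function.update 1 m (1 + t)) := by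
      ext a b
      by_cases hab : a = b
      · subst hab
        by_cases ham : a = m
        · subst ham; simp
        · simp [ham, Ne.symm ham]
      · rw [Matrix.diagonal_apply_ne _ hab, Matrix.add_apply, Matrix.one_apply_ne hab,
          Matrix.single_apply, if_neg (by rintro ⟨rfl, rfl⟩; exact hab rfl), add_zero]
    rw [this, Matrix.det_diagonal, Finset.prod_update_of_mem (Finset.mem_univ m)]
    simp
  · exact Matrix.det_transvection_of_ne m i h t

theorem mul_one_add_single_apply (U : Matrix (Fin n) (Fin n) ℂ) (i m a b : Fin n) (t : ℂ) :
    (U * (1 + Matrix.single m i t)) a b = U a b + if b = i then t * U a m else 0 := by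
  rw [mul_add, mul_one, Matrix.add_apply]
  congr 1
  split_ifs with h
  · subst h; rw [Matrix.mul_single_apply_same, mul_comm]
  · exact Matrix.mul_single_apply_of_ne _ _ _ _ _ h _

theorem trace_mul_one_add_single (U : Matrix (Fin n) (Fin n) ℂ) (i m : Fin n) (t : ℂ) :
    (U * (1 + Matrix.single m i t)).trace = U.trace + t * U i m := by
  simp [Matrix.trace, mul_one_add_single_apply, Finset.sum_add_distrib]

open MvPolynomial in
/-- Translating by an elementary matrix in the integrals `permTraceIntegral`. -/
theorem integral_perm_trace_single {k : ℕ} (S : Finset (Fin n)) (σ : Equiv.Perm (Fin n)) {M : ℕ}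
    (hM : S.card + M = k * n) (i m : Fin n) (t : ℂ) :
    ∫ U : SU n, (∏ j ∈ S, (U.1 (σ j) j + if j = i then t * U.1 (σ j) m else 0)) *
        (U.1.trace + t * U.1 i m) ^ M ∂haarSU n =
      (if m = i then 1 + t else 1) ^ k * permTraceIntegral S σ M := by
  set f : MvPolynomial (Fin n × Fin n) ℂ := (∏ j ∈ S, X (σ j, j)) * (∑ i, X (i, i)) ^ M with hf
  have hfh : f.IsHomogeneous (k * n) := by
    rw [← hM]
    refine IsHomogeneous.mul ?_ ?_
    · have := IsHomogeneous.prod S (fun j => (X (σ j, j) : MvPolynomial (Fin n × Fin n) ℂ))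
        (fun _ => 1) fun j _ => isHomogeneous_X _ _
      simpa using this
    · have := (IsHomogeneous.sum Finset.univ
        (fun i => (X (i, i) : MvPolynomial (Fin n × Fin n) ℂ)) 1
        fun j _ => isHomogeneous_X _ _).pow M
      simpa using this
  have h := integral_eval_mul_right k hfh (1 + Matrix.single m i t)
  rw [det_one_add_single] at h
  have he : ∀ A : Matrix (Fin n) (Fin n) ℂ, eval (fun ij => A ij.1 ij.2) f =
      (∏ j ∈ S, A (σ j) j) * A.trace ^ M := by
    intro A
    simp [hf, Matrix.trace]
  simp_rw [he, trace_mul_one_add_single, mul_one_add_single_apply] at h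
  exact h

theorem continuous_entry (a b : Fin n) : Continuous fun U : SU n => U.1 a b :=
  continuous_subtype_val.matrix_elem a b

theorem continuous_trace : Continuous fun U : SU n => U.1.trace :=
  continuous_subtype_val.matrix_trace

theorem continuous_prod_entry (S : Finset (Fin n)) (σ : Equiv.Perm (Fin n)) :
    Continuous fun U : SU n => ∏ j ∈ S, U.1 (σ j) j :=
  continuous_finsetProd _ fun j _ => continuous_entry (σ j) j

/-- Scale column `m` by `1 + t` and differentiate at `t = 0`. The other columns do not move, the
trace has velocity `U_mm`, which restores the missing factor, and the determinant `(1 + t)^k`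
contributes `k`. -/
theorem permTraceIntegral_of_apply_eq_self {k : ℕ} {S : Finset (Fin n)} {σ : Equiv.Perm (Fin n)}
    {M : ℕ} (hM : S.card + M = k * n) {m : Fin n} (hm : m ∈ S) (hσ : σ m = m) :
    (M + 1) * permTraceIntegral S σ M = k * permTraceIntegral (S.erase m) σ (M + 1) := by
  have hM' : (S.erase m).card + (M + 1) = k * n := by
    rw [← hM, ← Finset.card_erase_add_one hm]; ring
  have h1 : ∀ t : ℂ, ∫ U : SU n, (∏ j ∈ S.erase m, U.1 (σ j) j) *
      (U.1.trace + t * U.1 m m) ^ (M + 1) ∂haarSU n =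
      (1 + t) ^ k * permTraceIntegral (S.erase m) σ (M + 1) := by
    intro t
    have := integral_perm_trace_single (S.erase m) σ hM' m m t
    rw [if_pos rfl] at this
    rw [← this]
    congr 1; ext U; congr 1
    refine Finset.prod_congr rfl fun j hj => ?_
    rw [if_neg (Finset.ne_of_mem_erase hj), add_zero]
  have h3 : HasDerivAt (fun t : ℂ => (1 + t) ^ k * permTraceIntegral (S.erase m) σ (M + 1))
      (k * permTraceIntegral (S.erase m) σ (M + 1)) 0 := by
    have := (((hasDerivAt_id (0 : ℂ)).const_add 1).fun_pow k).mul_const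
      (permTraceIntegral (S.erase m) σ (M + 1))
    simpa using this
  have h2 := integral_deriv_mul_pow (haarSU n) (q := fun _ => 0)
    (continuous_prod_entry (S.erase m) σ) continuous_const continuous_trace
    (continuous_entry m m) M h3 (fun t => by simpa using h1 t)
  rw [← h2]
  simp only [zero_mul, integral_zero, zero_add]
  rw [permTraceIntegral]
  congr 1
  congr 1; ext U
  rw [← Finset.mul_prod_erase S _ hm, hσ]
  ring

/-- Add `t` times column `m` to column `i`: the determinant of this shear is `1`, so the derivative
is zero. The trace has velocity `U_im`, the missing factor for `m`. The entry `U_(σ i) i` has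
velocity `U_(σ i) m`, which is the factor for `m` of `σ * swap m i`, a permutation fixing `i`. -/
theorem permTraceIntegral_of_apply_eq {k : ℕ} {S : Finset (Fin n)} {σ : Equiv.Perm (Fin n)}
    {M : ℕ} (hM : S.card + M = k * n) {m i : Fin n} (hm : m ∈ S) (hi : i ∈ S) (him : m ≠ i)
    (hσ : σ m = i) :
    (M + 1) * permTraceIntegral S σ M =
      -permTraceIntegral (S.erase i) (σ * Equiv.swap m i) (M + 1) := by
  have hM' : (S.erase m).card + (M + 1) = k * n := by
    rw [← hM, ← Finset.card_erase_add_one hm]; ring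
  have hi' : i ∈ S.erase m := Finset.mem_erase.mpr ⟨him.symm, hi⟩
  have hm' : m ∈ S.erase i := Finset.mem_erase.mpr ⟨him, hm⟩
  have h1 : ∀ t : ℂ, ∫ U : SU n, (U.1 (σ i) i + t * U.1 (σ i) m) *
      (∏ j ∈ (S.erase m).erase i, U.1 (σ j) j) *
      (U.1.trace + t * U.1 i m) ^ (M + 1) ∂haarSU n =
      permTraceIntegral (S.erase m) σ (M + 1) := by
    intro t
    have := integral_perm_trace_single (S.erase m) σ hM' i m t
    rw [if_neg him, one_pow, one_mul] at this
    rw [← this]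
    congr 1; ext U; congr 1
    rw [← Finset.mul_prod_erase (S.erase m) _ hi', if_pos rfl]
    congr 1
    refine Finset.prod_congr rfl fun j hj => ?_
    rw [if_neg (Finset.ne_of_mem_erase hj), add_zero]
  have h3 := integral_deriv_mul_pow (haarSU n)
    (p := fun U => U.1 (σ i) i * ∏ j ∈ (S.erase m).erase i, U.1 (σ j) j)
    (q := fun U => U.1 (σ i) m * ∏ j ∈ (S.erase m).erase i, U.1 (σ j) j)
    ((continuous_entry _ _).mul (continuous_prod_entry _ σ))
    ((continuous_entry _ _).mul (continuous_prod_entry _ σ)) continuous_trace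
    (continuous_entry i m) M (hasDerivAt_const 0 (permTraceIntegral (S.erase m) σ (M + 1)))
    (fun t => by rw [← h1 t]; congr 1; ext U; ring)
  rw [add_comm] at h3
  rw [permTraceIntegral, permTraceIntegral]
  refine Eq.trans ?_ ((eq_neg_of_add_eq_zero_left h3).trans (congrArg Neg.neg ?_))
  · congr 1; congr 1; ext U
    rw [← Finset.mul_prod_erase S _ hm, ← Finset.mul_prod_erase (S.erase m) _ hi', hσ]
    ring
  · congr 1; ext U
    rw [← Finset.mul_prod_erase (S.erase i) _ hm', Finset.erase_right_comm]
    congr 2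
    · simp
    · refine Finset.prod_congr rfl fun j hj => ?_
      simp only [Finset.mem_erase] at hj
      rw [Equiv.Perm.mul_apply, Equiv.swap_apply_of_ne_of_ne hj.1 hj.2.1]

/-- The signed sum of `permTraceIntegral` over the permutations supported in `S`. -/
noncomputable def signedTraceIntegral (S : Finset (Fin n)) (M : ℕ) : ℂ :=
  ∑ σ : Equiv.Perm (Fin n) with ∀ j, j ∉ S → σ j = j,
    ((Equiv.Perm.sign σ : ℤ) : ℂ) * permTraceIntegral S σ M

/-- Split the permutations by the value `σ m`. The case `σ m = m` gives the first term. For `σ m = i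
≠ m`, composing with `swap m i` is a bijection onto the permutations supported in `S.erase i`, and
its sign cancels the minus sign of the shear relation. -/
theorem signedTraceIntegral_step {k : ℕ} {S : Finset (Fin n)} {M : ℕ}
    (hM : S.card + M = k * n) {m : Fin n} (hm : m ∈ S) :
    (M + 1) * signedTraceIntegral S M = k * signedTraceIntegral (S.erase m) (M + 1) +
      ∑ i ∈ S.erase m, signedTraceIntegral (S.erase i) (M + 1) := by
  have hmaps : ∀ σ ∈ ({σ | ∀ j, j ∉ S → σ j = j} : Finset (Equiv.Perm (Fin n))), σ m ∈ S := by
    intro σ hσ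
    rw [Finset.mem_filter] at hσ
    by_contra h
    have := hσ.2 _ h
    rw [σ.injective this] at h
    exact h hm
  rw [signedTraceIntegral, Finset.mul_sum, ← Finset.sum_fiberwise_of_maps_to hmaps,
    ← Finset.add_sum_erase S _ hm]
  congr 1
  · rw [signedTraceIntegral, Finset.mul_sum, Finset.filter_filter]
    refine Finset.sum_congr ?_ fun σ hσ => ?_
    · ext σ
      simp only [Finset.mem_filter, Finset.mem_univ, true_and, Finset.mem_erase]
      constructor
      · rintro ⟨h1, h2⟩ j hj
        by_cases hjm : j = m
        · rw [hjm, h2]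
        · exact h1 j fun h => hj ⟨hjm, h⟩
      · intro h
        exact ⟨fun j hj => h j fun h' => hj h'.2, h m fun h' => h'.1 rfl⟩
    · simp only [Finset.mem_filter, Finset.mem_univ, true_and, Finset.mem_erase] at hσ
      have := permTraceIntegral_of_apply_eq_self hM hm (hσ m fun h' => h'.1 rfl)
      linear_combination ((Equiv.Perm.sign σ : ℤ) : ℂ) * this
  · refine Finset.sum_congr rfl fun i hi => ?_
    obtain ⟨him, hiS⟩ := Finset.mem_erase.mp hi
    rw [signedTraceIntegral, Finset.filter_filter]
    refine Finset.sum_nbij' (fun σ => σ * Equiv.swap m i) (fun σ => σ * Equiv.swap m i)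
      ?_ ?_ ?_ ?_ ?_
    · intro σ hσ
      simp only [Finset.mem_filter, Finset.mem_univ, true_and, Finset.mem_erase] at hσ ⊢
      intro j hj
      by_cases hji : j = i
      · rw [hji, Equiv.Perm.mul_apply, Equiv.swap_apply_right, hσ.2]
      · have hjS : j ∉ S := fun h => hj ⟨hji, h⟩
        rw [Equiv.Perm.mul_apply, Equiv.swap_apply_of_ne_of_ne (by rintro rfl; exact hjS hm) hji]
        exact hσ.1 j hjS
    · intro σ hσ
      simp only [Finset.mem_filter, Finset.mem_univ, true_and, Finset.mem_erase] at hσ ⊢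
      refine ⟨fun j hj => ?_, ?_⟩
      · rw [Equiv.Perm.mul_apply, Equiv.swap_apply_of_ne_of_ne (by rintro rfl; exact hj hm)
          (by rintro rfl; exact hj hiS)]
        exact hσ j fun h => hj h.2
      · rw [Equiv.Perm.mul_apply, Equiv.swap_apply_left]
        exact hσ i fun h => h.1 rfl
    · intro σ _; simp [mul_assoc]
    · intro σ _; simp [mul_assoc]
    · intro σ hσ
      simp only [Finset.mem_filter, Finset.mem_univ, true_and] at hσ
      have := permTraceIntegral_of_apply_eq hM hm hiS him.symm hσ.2
      rw [Equiv.Perm.sign_mul, Equiv.Perm.sign_swap him.symm]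
      push_cast
      linear_combination ((Equiv.Perm.sign σ : ℤ) : ℂ) * this

/-- By induction all sets of one size give the same value, so the step for a set of size `r + 1`
multiplies by `k + r` and divides by `M + 1`. -/
theorem signedTraceIntegral_eq {k : ℕ} (r : ℕ) : ∀ (S : Finset (Fin n)) (M : ℕ),
    S.card = r → r + M = k * n → signedTraceIntegral S M * ((k * n)! : ℂ) =
      (M ! : ℂ) * (∏ l ∈ Finset.range r, ((k : ℂ) + l)) * signedTraceIntegral (∅ : Finset (Fin n)) (k * n) := by
  induction r with
  | zero =>
    intro S M hS hM
    rw [Finset.card_eq_zero] at hS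
    subst hS
    rw [zero_add] at hM
    subst hM
    simp [mul_comm]
  | succ r ih =>
    intro S M hS hM
    obtain ⟨m, hm⟩ : S.Nonempty := Finset.card_pos.mp (by omega)
    have hstep := signedTraceIntegral_step (k := k) (M := M) (by rw [hS, hM]) hm
    have hih : ∀ i ∈ S, signedTraceIntegral (S.erase i) (M + 1) * ((k * n)! : ℂ) =
        ((M + 1)! : ℂ) * (∏ l ∈ Finset.range r, ((k : ℂ) + l)) *
          signedTraceIntegral (∅ : Finset (Fin n)) (k * n) := fun i hi =>
      ih _ _ (by rw [Finset.card_erase_of_mem hi, hS]; rfl) (by omega)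
    have h1 : (((M : ℂ) + 1)) ≠ 0 := by exact_mod_cast Nat.succ_ne_zero M
    apply mul_left_cancel₀ h1
    rw [← mul_assoc, hstep, add_mul, mul_assoc, hih m hm, Finset.sum_mul,
      Finset.sum_congr rfl fun i hi => hih i (Finset.mem_of_mem_erase hi),
      Finset.sum_const (s := S.erase m),
      Finset.card_erase_of_mem hm, hS, Finset.prod_range_succ, Nat.factorial_succ]
    push_cast
    simp only [nsmul_eq_mul]
    ring

theorem powTransform_one (N : ℕ) :
    powTransform N (1 : Matrix (Fin n) (Fin n) ℂ) = ∫ U : SU n, U.1.trace ^ N ∂haarSU n := by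
  unfold powTransform
  simp_rw [sum_mul_eq_trace, Matrix.transpose_one, one_mul]

theorem signedTraceIntegral_empty (N : ℕ) :
    signedTraceIntegral (∅ : Finset (Fin n)) N = powTransform N (1 : Matrix (Fin n) (Fin n) ℂ) := by
  rw [powTransform_one, signedTraceIntegral, Finset.sum_eq_single 1]
  · simp [permTraceIntegral]
  · intro σ hσ h
    exact absurd (Equiv.ext fun j => (Finset.mem_filter.mp hσ).2 j (by simp)) h
  · intro h
    exact absurd (by simp) h

theorem signedTraceIntegral_univ (N : ℕ) :
    signedTraceIntegral (Finset.univ : Finset (Fin n)) N = powTransform N (1 : Matrix (Fin n) (Fin n) ℂ) := by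
  rw [powTransform_one, signedTraceIntegral]
  simp only [Finset.mem_univ, not_true_eq_false, false_imp_iff, implies_true, Finset.filter_true,
    permTraceIntegral]
  simp_rw [← integral_const_mul]
  rw [← integral_finsetSum]
  · congr 1; ext U
    simp_rw [← mul_assoc, ← Finset.sum_mul]
    have h := (Matrix.mem_specialUnitaryGroup_iff.mp U.2).2
    rw [Matrix.det_apply'] at h
    rw [h, one_mul]
  · intro σ _
    exact integrable_of_continuous _
      (continuous_const.mul ((continuous_prod_entry _ σ).mul (continuous_trace.pow N)))

/-- The value of `∫ (tr U) ^ {kn}`. -/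
theorem powTransform_one_mul (k : ℕ) :
    powTransform (k * n) (1 : Matrix (Fin n) (Fin n) ℂ) * ∏ m ∈ Finset.range n, ((k + m)! : ℂ) =
      ((k * n)! : ℂ) * ∏ m ∈ Finset.range n, (m ! : ℂ) := by
  induction k with
  | zero => simp [powTransform_one]
  | succ k ih =>
    -- For the full index set the signed sum is `det U = 1` times a power of the trace. The relation
    -- for `k + 1` thus compares the moment of order `kn` with that of order `(k + 1)n`.
    have h := signedTraceIntegral_eq (n := n) (k := k + 1) n Finset.univ (k * n) (by simp)
      (by ring)
    rw [signedTraceIntegral_univ, signedTraceIntegral_empty] at h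
    have hprod : ∏ m ∈ Finset.range n, ((k + 1 + m)! : ℂ) =
        (∏ m ∈ Finset.range n, (((k + 1 : ℕ) : ℂ) + m)) * ∏ m ∈ Finset.range n, ((k + m)! : ℂ) := by
      rw [← Finset.prod_mul_distrib]
      refine Finset.prod_congr rfl fun m _ => ?_
      rw [show k + 1 + m = (k + m) + 1 by ring, Nat.factorial_succ]
      push_cast; ring
    have h0 : ((k * n)! : ℂ) ≠ 0 := Nat.cast_ne_zero.mpr (Nat.factorial_ne_zero _)
    apply mul_left_cancel₀ h0
    rw [hprod]
    linear_combination (((k + 1) * n)! : ℂ) * ih - (∏ m ∈ Finset.range n, ((k + m)! : ℂ)) * h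

end Recursion

theorem detPowCoeff_mul_factorial (n k : ℕ) (α : Fin n × Fin n →₀ ℕ)
    (hα : ∑ i, ∑ j, α (i, j) = k * n) :
    (detPowCoeff n k α : ℂ) * ∏ i, ∏ j, ((α (i, j))! : ℂ) =
      (∏ m ∈ Finset.range n, ((k + m)! : ℂ)) / (∏ m ∈ Finset.range n, (m ! : ℂ)) *
        ∫ U : SU n, ∏ i, ∏ j, U.1 i j ^ α (i, j) ∂haarSU n := by
  have hα' : ∑ ij, α ij = k * n := by rw [Fintype.sum_prod_type, hα]
  have h1 := multinomial_mul_integral k α hα'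
  have h2 := powTransform_one_mul (n := n) k
  have h3 : (∏ ij, ((α ij)! : ℂ)) * Nat.multinomial Finset.univ α = ((k * n)! : ℂ) := by
    rw [← hα']
    exact_mod_cast Nat.multinomial_spec Finset.univ α
  simp_rw [← Fintype.prod_prod_type' (f := fun i j => ((α (i, j))! : ℂ))]
  have h4 : ∀ U : SU n, ∏ i, ∏ j, U.1 i j ^ α (i, j) = ∏ ij, U.1 ij.1 ij.2 ^ α ij := fun U =>
    (Fintype.prod_prod_type' (f := fun i j => U.1 i j ^ α (i, j))).symm
  simp_rw [h4]
  have e1 : ∏ m ∈ Finset.range n, (m ! : ℂ) ≠ 0 :=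
    Finset.prod_ne_zero_iff.mpr fun m _ => Nat.cast_ne_zero.mpr (Nat.factorial_ne_zero m)
  have e2 : ((k * n)! : ℂ) ≠ 0 := Nat.cast_ne_zero.mpr (Nat.factorial_ne_zero _)
  set P := powTransform (k * n) (1 : Matrix (Fin n) (Fin n) ℂ)
  -- The closed form shows that the trace moment is nonzero, which allows dividing by it.
  have e3 : P ≠ 0 := by
    intro h
    rw [h, zero_mul] at h2
    exact mul_ne_zero e2 e1 h2.symm
  rw [div_mul_eq_mul_div, eq_div_iff e1]
  apply mul_left_cancel₀ e3
  set I := ∫ U : SU n, ∏ ij : Fin n × Fin n, U.1 ij.1 ij.2 ^ α ij ∂haarSU n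
  linear_combination (-(∏ ij, ((α ij)! : ℂ)) * ∏ m ∈ Finset.range n, (m ! : ℂ)) * h1
    + (I * ∏ m ∈ Finset.range n, (m ! : ℂ)) * h3 - I * h2

/-- The multiindex all of whose entries are `1`. -/
noncomputable def allOnes (n : ℕ) : Fin n × Fin n →₀ ℕ :=
  Finsupp.equivFunOnFinite.symm fun _ => 1

/-! ### Latin squares in the expansion of `det^n`. -/

section Coefficient

variable {n : ℕ}

/-- The exponent of `X_ab` in this monomial counts the `s` with `p s a = b`; all these counts are
`1` exactly under the bijectivity condition. -/
theorem coeff_allOnes_prod (p : Fin n → Equiv.Perm (Fin n)) :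
    MvPolynomial.coeff (allOnes n)
      (∏ s, ∏ i, (MvPolynomial.X (i, p s i) : MvPolynomial (Fin n × Fin n) ℤ)) =
      if ∀ i, Function.Bijective fun s => p s i then 1 else 0 := by
  have h1 : (∏ s, ∏ i, (MvPolynomial.X (i, p s i) : MvPolynomial (Fin n × Fin n) ℤ)) =
      MvPolynomial.monomial (∑ s, ∑ i, Finsupp.single (i, p s i) 1) 1 := by
    simp_rw [MvPolynomial.monomial_sum_one]
    rfl
  have h2 : (∑ s, ∑ i, Finsupp.single (i, p s i) 1 = allOnes n) ↔
      ∀ i, Function.Bijective fun s => p s i := by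
    have h3 : ∀ a b, (∑ s, ∑ i, Finsupp.single (i, p s i) 1 : Fin n × Fin n →₀ ℕ) (a, b) =
        (Finset.univ.filter fun s => p s a = b).card := by
      intro a b
      rw [Finset.card_filter, Finsupp.finsetSum_apply]
      refine Finset.sum_congr rfl fun s _ => ?_
      rw [Finsupp.finsetSum_apply, Finset.sum_eq_single a]
      · simp [Finsupp.single_apply]
      · intro i _ hi
        simp [hi]
      · simp
    constructor
    · intro h a
      rw [Function.bijective_iff_existsUnique]
      intro b
      have h4 := h3 a b
      rw [h] at h4
      obtain ⟨s, hs⟩ := Finset.card_eq_one.mp h4.symm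
      refine ⟨s, ?_, fun s' hs' => ?_⟩
      · have : s ∈ Finset.univ.filter fun s => p s a = b := by rw [hs]; simp
        simpa using this
      · have : s' ∈ Finset.univ.filter fun s => p s a = b := by simpa using hs'
        rw [hs] at this
        simpa using this
    · intro h
      ext ⟨a, b⟩
      rw [h3]
      obtain ⟨s, hs, hu⟩ := (Function.bijective_iff_existsUnique _).mp (h a) b
      refine Finset.card_eq_one.mpr ⟨s, ?_⟩
      ext s'
      simp only [Finset.mem_filter, Finset.mem_univ, true_and, Finset.mem_singleton]
      exact ⟨hu s', fun e => e ▸ hs⟩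
  rw [h1, MvPolynomial.coeff_monomial]
  simp only [h2]

theorem LatinSquare.symbolPerm_injective :
    Function.Injective (LatinSquare.symbolPerm : LatinSquare n → Fin n → Equiv.Perm (Fin n)) := by
  intro S S' h
  apply Subtype.ext
  ext1 i j
  have h1 := S'.entry_position (S.1 i j) i
  have h2 : S'.position (S.1 i j) i = S.position (S.1 i j) i :=
    (congrArg (fun σ : Fin n → Equiv.Perm (Fin n) => σ (S.1 i j) i) h).symm
  have h3 : S.position (S.1 i j) i = j := (S.2.1 i).1 (S.entry_position (S.1 i j) i)
  rw [h2, h3] at h1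
  exact h1.symm

theorem LatinSquare.bijective_symbolPerm_apply (S : LatinSquare n) (i : Fin n) :
    Function.Bijective fun s => S.symbolPerm s i := by
  apply Finite.injective_iff_bijective.mp
  intro s s' h
  have h' : S.position s i = S.position s' i := h
  rw [← S.entry_position s i, h', S.entry_position]

theorem LatinSquare.exists_symbolPerm_eq (p : Fin n → Equiv.Perm (Fin n))
    (hp : ∀ i, Function.Bijective fun s => p s i) :
    ∃ S : LatinSquare n, S.symbolPerm = p := by
  have key : ∀ i j, p ((Equiv.ofBijective _ (hp i)).symm j) i = j := fun i j =>
    (Equiv.ofBijective _ (hp i)).apply_symm_apply j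
  let S : LatinSquare n := ⟨fun i j => (Equiv.ofBijective _ (hp i)).symm j,
    fun i => (Equiv.ofBijective _ (hp i)).symm.bijective, fun j => by
      apply Finite.injective_iff_bijective.mp
      intro i i' h
      have e1 := key i j
      have e2 := key i' j
      simp only at h
      rw [← h] at e2
      exact (p _).injective (e1.trans e2.symm)⟩
  refine ⟨S, ?_⟩
  ext1 k
  ext1 i
  have h1 : S.1 i (S.position k i) = k := S.entry_position k i
  have h2 := key i (S.position k i)
  change (Equiv.ofBijective _ (hp i)).symm (S.position k i) = k at h1
  rw [h1] at h2
  exact h2.symm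

/-- Expand `det^n` over `n`-tuples of permutations, one for each symbol. The tuples that produce the
squarefree monomial in all variables are exactly the families `symbolPerm` of Latin squares. -/
theorem detPowCoeff_allOnes :
    detPowCoeff n n (allOnes n) =
      ∑ S : LatinSquare n, ∏ s, ((Equiv.Perm.sign (S.symbolPerm s) : ℤˣ) : ℤ) := by
  have h1 : (Matrix.mvPolynomialX (Fin n) (Fin n) ℤ).det ^ n =
      ∑ p : Fin n → Equiv.Perm (Fin n),
        MvPolynomial.C (∏ s, ((Equiv.Perm.sign (p s) : ℤˣ) : ℤ)) *
          ∏ s, ∏ i, MvPolynomial.X (i, p s i) := by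
    have h2 : (Matrix.mvPolynomialX (Fin n) (Fin n) ℤ).det ^ n =
        ∏ _s : Fin n, ∑ σ : Equiv.Perm (Fin n),
          MvPolynomial.C ((Equiv.Perm.sign σ : ℤˣ) : ℤ) * ∏ i, MvPolynomial.X (i, σ i) := by
      rw [Finset.prod_const, Finset.card_univ, Fintype.card_fin, ← Matrix.det_transpose,
        Matrix.det_apply']
      simp [Matrix.mvPolynomialX]
    rw [h2, Finset.prod_univ_sum]
    simp_rw [Finset.prod_mul_distrib, map_prod]
    rfl
  rw [detPowCoeff, h1, MvPolynomial.coeff_sum]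
  simp_rw [MvPolynomial.coeff_C_mul, coeff_allOnes_prod, mul_ite, mul_one, mul_zero]
  rw [← Finset.sum_filter]
  symm
  refine Finset.sum_nbij LatinSquare.symbolPerm ?_ ?_ ?_ fun _ _ => rfl
  · intro S _
    simpa using S.bijective_symbolPerm_apply
  · exact LatinSquare.symbolPerm_injective.injOn
  · intro p hp
    obtain ⟨S, hS⟩ := LatinSquare.exists_symbolPerm_eq p (by simpa using hp)
    exact ⟨S, by simp, hS⟩

theorem evenLatinCount_sub_oddLatinCount :
    (evenLatinCount n : ℤ) - oddLatinCount n =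
      (-1) ^ (n * (n - 1) / 2) * detPowCoeff n n (allOnes n) := by
  classical
  rw [evenLatinCount, oddLatinCount, Nat.card_eq_fintype_card, Nat.card_eq_fintype_card,
    Fintype.card_subtype, Fintype.card_subtype, Finset.card_filter, Finset.card_filter,
    detPowCoeff_allOnes, Finset.mul_sum, Nat.cast_sum, Nat.cast_sum, ← Finset.sum_sub_distrib]
  refine Finset.sum_congr rfl fun S _ => ?_
  have h1 : (-1) ^ (n * (n - 1) / 2) * ∏ s, ((Equiv.Perm.sign (S.symbolPerm s) : ℤˣ) : ℤ) =
      ((S.sign : ℤˣ) : ℤ) := by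
    simp [LatinSquare.sign]
  rw [h1]
  rcases Int.units_eq_one_or S.sign with h | h <;> rw [h] <;> simp

end Coefficient

/-! ### Bounding the integral by AM-GM. -/

section Bound

variable {n : ℕ}

theorem prod_sq_mul_pow_le {z : Fin n → ℝ} (hz : ∀ i, 0 ≤ z i) (hs : ∑ i, z i = 1) :
    (∏ i, z i) * (n : ℝ) ^ n ≤ 1 := by
  rcases Nat.eq_zero_or_pos n with rfl | hn
  · simp
  have hn' : (0 : ℝ) < n := Nat.cast_pos.mpr hn
  have h := Real.geom_mean_le_arith_mean_weighted Finset.univ (fun _ : Fin n => (n : ℝ)⁻¹) z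
    (fun _ _ => by positivity) (by simp [hn'.ne']) fun i _ => hz i
  rw [← Finset.mul_sum, hs, mul_one, Real.finsetProd_rpow _ _ fun i _ => hz i] at h
  have h0 : 0 ≤ ∏ i, z i := Finset.prod_nonneg fun i _ => hz i
  have h2 := pow_le_pow_left₀ (Real.rpow_nonneg h0 _) h n
  rw [Real.rpow_inv_natCast_pow h0 hn.ne', inv_pow] at h2
  calc _ ≤ ((n : ℝ) ^ n)⁻¹ * (n : ℝ) ^ n := by gcongr
    _ = 1 := inv_mul_cancel₀ (by positivity)

/-- The squared moduli in each row sum to `1`, so by AM-GM their product is at most `n^(-n)`; there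
are `n` rows. -/
theorem norm_prod_entries_sq_mul_le (U : SU n) :
    ‖∏ i, ∏ j, U.1 i j‖ ^ 2 * (n : ℝ) ^ (n ^ 2) ≤ 1 := by
  have hrow : ∀ i, ∑ j, ‖U.1 i j‖ ^ 2 = 1 := by
    intro i
    have h := (Matrix.mem_unitaryGroup_iff.mp (Matrix.mem_specialUnitaryGroup_iff.mp U.2).1)
    have h2 := congrFun (congrFun h i) i
    rw [Matrix.mul_apply, Matrix.one_apply_eq] at h2
    have h3 : ∀ j, U.1 i j * (star U.1) j i = ((‖U.1 i j‖ ^ 2 : ℝ) : ℂ) := by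
      intro j
      rw [Matrix.star_apply, Complex.star_def, Complex.mul_conj, Complex.normSq_eq_norm_sq]
    simp_rw [h3] at h2
    exact_mod_cast h2
  have h1 : ‖∏ i, ∏ j, U.1 i j‖ ^ 2 * (n : ℝ) ^ (n ^ 2) =
      ∏ i : Fin n, ((∏ j, ‖U.1 i j‖ ^ 2) * (n : ℝ) ^ n) := by
    rw [Finset.prod_mul_distrib, Finset.prod_const, Finset.card_univ, Fintype.card_fin, ← pow_mul,
      ← sq]
    simp_rw [norm_prod, Finset.prod_pow]
  rw [h1]
  refine Finset.prod_le_one (fun i _ => by positivity) fun i _ => ?_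
  exact prod_sq_mul_pow_le (fun j => by positivity) (hrow i)

theorem norm_integral_prod_sq_mul_le :
    ‖∫ U : SU n, ∏ i, ∏ j, U.1 i j ∂haarSU n‖ ^ 2 * (n : ℝ) ^ (n ^ 2) ≤ 1 := by
  rcases Nat.eq_zero_or_pos n with rfl | hn
  · simp
  have hpos : (0 : ℝ) < (n : ℝ) ^ (n ^ 2) := by positivity
  have h1 : ∀ U : SU n, ‖∏ i, ∏ j, U.1 i j‖ ≤ √(((n : ℝ) ^ (n ^ 2))⁻¹) := by
    intro U
    apply Real.le_sqrt_of_sq_le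
    rw [← one_div, le_div_iff₀ hpos]
    exact norm_prod_entries_sq_mul_le U
  have h2 := norm_integral_le_of_norm_le_const (μ := haarSU n) (Eventually.of_forall h1)
  rw [probReal_univ, mul_one] at h2
  rw [← le_div_iff₀ hpos, one_div, ← Real.sq_sqrt (inv_nonneg.mpr hpos.le)]
  exact pow_le_pow_left₀ (norm_nonneg _) h2 2

theorem evenLatinCount_sub_oddLatinCount_sq_mul_le :
    ((evenLatinCount n : ℝ) - oddLatinCount n) ^ 2 * (n : ℝ) ^ (n ^ 2) ≤
      (∏ m ∈ Finset.range n, ((n + m)! : ℝ) / (m ! : ℝ)) ^ 2 := by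
  set D := ∏ m ∈ Finset.range n, ((n + m)! : ℝ) / (m ! : ℝ) with hD
  have h1 := detPowCoeff_mul_factorial n n (allOnes n) (by simp [allOnes])
  have h2 : (detPowCoeff n n (allOnes n) : ℂ) =
      (D : ℂ) * ∫ U : SU n, ∏ i, ∏ j, U.1 i j ∂haarSU n := by
    simp only [allOnes, Finsupp.equivFunOnFinite_symm_apply_apply, Nat.factorial_one, Nat.cast_one,
      Finset.prod_const_one, mul_one, pow_one] at h1
    rw [allOnes, h1, hD]
    push_cast
    rw [Finset.prod_div_distrib]
  have h3 : ((evenLatinCount n : ℝ) - oddLatinCount n) ^ 2 =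
      ‖(detPowCoeff n n (allOnes n) : ℂ)‖ ^ 2 := by
    have h4 := congrArg (fun z : ℤ => (z : ℝ)) (evenLatinCount_sub_oddLatinCount (n := n))
    push_cast at h4
    rw [h4, mul_pow, ← pow_mul, mul_comm (_ / 2) 2, pow_mul, neg_one_sq, one_pow, one_mul,
      Complex.norm_intCast, sq_abs]
  rw [h3, h2, norm_mul, mul_pow, mul_assoc, Complex.norm_real, Real.norm_eq_abs, sq_abs]
  exact mul_le_of_le_one_right (sq_nonneg D) norm_integral_prod_sq_mul_le

end Bound

/-! ### Stable polynomials and capacity. -/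

section Stable

open MvPolynomial

variable {ι : Type*} [Fintype ι] [DecidableEq ι]

/-- Real homogeneous polynomials of degree `d` with positive coefficients which have no zero with
all coordinates in the open right half plane. -/
structure IsPosStable (d : ℕ) (p : MvPolynomial ι ℝ) : Prop where
  isHomogeneous : p.IsHomogeneous d
  coeff_pos : ∀ m : ι →₀ ℕ, ∑ i, m i = d → 0 < coeff m p
  aeval_ne_zero : ∀ z : ι → ℂ, (∀ i, 0 < (z i).re) → aeval z p ≠ 0

omit [DecidableEq ι] in
theorem sum_eq_of_mem_support {d : ℕ} {p : MvPolynomial ι ℝ} (hp : p.IsHomogeneous d)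
    {m : ι →₀ ℕ} (hm : m ∈ p.support) : ∑ i, m i = d := by
  have := hp (mem_support_iff.mp hm)
  rw [Finsupp.weight_apply, Finsupp.sum_fintype _ _ (by simp)] at this
  simpa using this

omit [DecidableEq ι] in
theorem sum_single (k : ι) (d : ℕ) : ∑ i, Finsupp.single k d i = d := by
  rw [Finset.sum_eq_single k (fun i _ hi => Finsupp.single_eq_of_ne hi) (by simp),
    Finsupp.single_eq_same]

omit [DecidableEq ι] in
theorem aeval_smul_of_isHomogeneous {d : ℕ} {p : MvPolynomial ι ℝ} (hp : p.IsHomogeneous d)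
    (c : ℂ) (z : ι → ℂ) : aeval (c • z) p = c ^ d * aeval z p := by
  rw [aeval_def, aeval_def, eval₂_eq', eval₂_eq', Finset.mul_sum]
  refine Finset.sum_congr rfl fun m hm => ?_
  simp_rw [Pi.smul_apply, smul_eq_mul, mul_pow, Finset.prod_mul_distrib, Finset.prod_pow_eq_pow_sum,
    sum_eq_of_mem_support hp hm]
  ring

omit [Fintype ι] [DecidableEq ι] in
theorem aeval_ofReal (p : MvPolynomial ι ℝ) (x : ι → ℝ) :
    aeval (fun i => (x i : ℂ)) p = ((eval x p : ℝ) : ℂ) :=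
  aeval_algebraMap_apply (A := ℝ) ℂ x p

theorem aeval_single_of_isHomogeneous {d : ℕ} {p : MvPolynomial ι ℝ} (hp : p.IsHomogeneous d)
    (k : ι) : aeval (Pi.single k (1 : ℂ)) p = ((coeff (Finsupp.single k d) p : ℝ) : ℂ) := by
  rw [aeval_def, eval₂_eq', Finset.sum_eq_single (Finsupp.single k d)]
  · rw [Finset.prod_eq_one, mul_one]; · rfl
    intro i _
    by_cases hi : i = k
    · subst hi; simp
    · simp [Ne.symm hi]
  · intro m hm hne
    have hsum := sum_eq_of_mem_support hp hm
    obtain ⟨i, hik, hi⟩ : ∃ i, i ≠ k ∧ m i ≠ 0 := by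
      by_contra! h
      apply hne
      ext i
      by_cases hi : i = k
      · subst hi
        rw [Finsupp.single_eq_same, ← hsum]
        exact (Finset.sum_eq_single i (fun j _ hj => h j hj) (by simp)).symm
      · rw [h i hi, Finsupp.single_eq_of_ne hi]
    rw [Finset.prod_eq_zero (Finset.mem_univ i), mul_zero]
    rw [Pi.single_eq_of_ne hik, zero_pow hi]
  · intro h
    rw [notMem_support_iff.mp h]; simp

/-- The univariate polynomial `t ↦ p (z + t eₖ)`. -/
noncomputable def slice (p : MvPolynomial ι ℝ) (z : ι → ℂ) (k : ι) : Polynomial ℂ :=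
  aeval (fun i => Polynomial.C (z i) + if i = k then Polynomial.X else 0) p

omit [Fintype ι] in
theorem eval_slice (p : MvPolynomial ι ℝ) (z : ι → ℂ) (k : ι) (t : ℂ) :
    (slice p z k).eval t = aeval (z + t • Pi.single k 1) p := by
  have h : (((Polynomial.aeval t : Polynomial ℂ →ₐ[ℂ] ℂ).restrictScalars ℝ).comp
      (aeval (fun i => Polynomial.C (z i) + if i = k then Polynomial.X else 0))) =
      (aeval (z + t • Pi.single k 1) : MvPolynomial ι ℝ →ₐ[ℝ] ℂ) := by
    ext i
    by_cases hi : i = k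
    · subst hi; simp
    · simp [hi]
  exact DFunLike.congr_fun h p

omit [Fintype ι] in
theorem derivative_slice (p : MvPolynomial ι ℝ) (z : ι → ℂ) (k : ι) :
    (slice p z k).derivative = slice (pderiv k p) z k := by
  induction p using MvPolynomial.induction_on with
  | C a =>
    simp only [slice, pderiv_C, map_zero, aeval_C]
    exact Polynomial.derivative_C
  | add p q hp hq =>
    simp only [slice, map_add] at hp hq ⊢
    rw [hp, hq]
  | mul_X p i hp =>
    simp only [slice, Derivation.leibniz, map_add, map_mul, aeval_X, smul_eq_mul,
      Polynomial.derivative_mul, pderiv_X] at hp ⊢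
    rw [hp]
    by_cases hi : i = k
    · subst hi; simp; ring
    · simp [hi]; ring

/-- If the slice were a constant `c`, homogeneity would give `p(s z + e_k) = c s^(d+1)` for `s ≠ 0`,
hence also at `s = 0`. Then `p(e_k)`, the coefficient of `X_k^(d+1)`, would vanish. -/
theorem IsPosStable.exists_isRoot_slice {d : ℕ} {p : MvPolynomial ι ℝ} (hp : IsPosStable (d + 1) p)
    (z : ι → ℂ) (k : ι) : ∃ r, (slice p z k).IsRoot r := by
  apply Complex.exists_root
  by_contra hdeg
  have hC := Polynomial.eq_C_of_degree_le_zero (not_lt.mp hdeg)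
  set c := (slice p z k).coeff 0
  set G : Polynomial ℂ := aeval (fun i => Polynomial.C (z i) * Polynomial.X +
    Polynomial.C ((Pi.single k 1 : ι → ℂ) i)) p with hG
  have hGe : ∀ s, G.eval s = aeval (s • z + Pi.single k 1) p := by
    intro s
    have h : (((Polynomial.aeval s : Polynomial ℂ →ₐ[ℂ] ℂ).restrictScalars ℝ).comp
        (aeval (fun i => Polynomial.C (z i) * Polynomial.X +
          Polynomial.C ((Pi.single k 1 : ι → ℂ) i)))) =
        (aeval (s • z + Pi.single k 1) : MvPolynomial ι ℝ →ₐ[ℝ] ℂ) := by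
      ext i
      simp only [AlgHom.comp_apply, aeval_X, AlgHom.coe_restrictScalars', map_add, map_mul,
        Polynomial.aeval_X, Polynomial.aeval_C, Algebra.algebraMap_self, RingHom.id_apply,
        Pi.add_apply, Pi.smul_apply, smul_eq_mul, mul_comm]
    exact DFunLike.congr_fun h p
  have hGX : G = Polynomial.C c * Polynomial.X ^ (d + 1) := by
    refine Polynomial.eq_of_infinite_eval_eq _ _
      (Set.Infinite.mono ?_ (Set.finite_singleton (0 : ℂ)).infinite_compl)
    intro s hs
    have hs0 : s ≠ 0 := hs
    have h1 := congrArg (Polynomial.eval s⁻¹) hC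
    rw [eval_slice, Polynomial.eval_C] at h1
    have h2 := aeval_smul_of_isHomogeneous hp.isHomogeneous s (z + s⁻¹ • Pi.single k 1)
    rw [h1, smul_add, smul_smul, mul_inv_cancel₀ hs0, one_smul] at h2
    show G.eval s = _
    rw [hGe, h2, Polynomial.eval_mul, Polynomial.eval_C, Polynomial.eval_pow, Polynomial.eval_X,
      mul_comm]
  have h0 := hGe 0
  rw [hGX, zero_smul, zero_add, aeval_single_of_isHomogeneous hp.isHomogeneous] at h0
  simp only [Polynomial.eval_mul, Polynomial.eval_C, Polynomial.eval_pow, Polynomial.eval_X,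
    zero_pow (Nat.succ_ne_zero d), mul_zero] at h0
  have := hp.coeff_pos (Finsupp.single k (d + 1)) (sum_single k (d + 1))
  exact this.ne (by exact_mod_cast h0)

/-- Gauss–Lucas: the roots `r` of a slice based in the right half plane have negative real part, so
the logarithmic derivative at `0`, the sum of the `1/(0 - r)`, has positive real part. The sum is
nonempty because the slice has a root. -/
theorem IsPosStable.pderiv {d : ℕ} {p : MvPolynomial ι ℝ} (hp : IsPosStable (d + 1) p) (k : ι) :
    IsPosStable d (pderiv k p) where
  isHomogeneous := hp.isHomogeneous.pderiv
  coeff_pos m hm := by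
    rw [coeff_pderiv]
    refine mul_pos (hp.coeff_pos _ ?_) (by positivity)
    simp only [Finsupp.add_apply, Finset.sum_add_distrib, hm, sum_single]
  aeval_ne_zero z hz := by
    have hne : (slice p z k).eval 0 ≠ 0 := by
      rw [eval_slice, zero_smul, add_zero]; exact hp.aeval_ne_zero z hz
    have hp0 : slice p z k ≠ 0 := by rintro h; rw [h] at hne; simp at hne
    have h1 := (IsAlgClosed.splits (slice p z k)).eval_derivative_eq_eval_mul_sum hne
    rw [derivative_slice, eval_slice, zero_smul, add_zero] at h1
    rw [h1]
    refine mul_ne_zero hne fun h => ?_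
    have hre : ∀ s : Multiset ℂ, (∀ r ∈ s, r.re < 0) → s ≠ 0 →
        0 < ((s.map fun r => 1 / (0 - r)).sum).re := by
      intro s
      induction s using Multiset.induction_on with
      | empty => simp
      | cons r s ih =>
        intro hs _
        rw [Multiset.map_cons, Multiset.sum_cons, Complex.add_re]
        have hr : r.re < 0 := hs r (Multiset.mem_cons_self r s)
        have hr1 : 0 < (1 / (0 - r)).re := by
          rw [one_div, Complex.inv_re]
          refine div_pos (by simpa using hr) (Complex.normSq_pos.mpr ?_)
          intro h; rw [zero_sub, neg_eq_zero] at h; rw [h] at hr; simp at hr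
        by_cases hs0 : s = 0
        · subst hs0; simpa using hr1
        · exact add_pos hr1 (ih (fun r hr => hs r (Multiset.mem_cons_of_mem hr)) hs0)
    have := hre (slice p z k).roots (fun r hr => ?_) ?_
    · rw [h] at this; simp at this
    · by_contra! hr0
      have hroot : (slice p z k).eval r = 0 := (Polynomial.mem_roots hp0).mp hr
      rw [eval_slice] at hroot
      refine hp.aeval_ne_zero _ (fun i => ?_) hroot
      by_cases hi : i = k
      · subst hi; simpa using by linarith [hz i]
      · simpa [hi] using hz i
    · obtain ⟨r, hr⟩ := hp.exists_isRoot_slice z k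
      intro h0
      have : r ∈ (slice p z k).roots := (Polynomial.mem_roots hp0).mpr hr
      rw [h0] at this; simp at this

omit [DecidableEq ι] in
theorem IsPosStable.eval_pos {d : ℕ} {p : MvPolynomial ι ℝ} (hp : IsPosStable d p) [Nonempty ι]
    {x : ι → ℝ} (hx : ∀ i, 0 < x i) : 0 < eval x p := by
  rw [eval_eq']
  refine Finset.sum_pos (fun m hm => mul_pos ?_ (Finset.prod_pos fun i _ => pow_pos (hx i) _)) ?_
  · exact hp.coeff_pos m (sum_eq_of_mem_support hp.isHomogeneous hm)
  · obtain ⟨k⟩ := ‹Nonempty ι›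
    exact ⟨Finsupp.single k d, mem_support_iff.mpr (hp.coeff_pos _ (sum_single k d)).ne'⟩

/-- Roots of real slices of stable homogeneous polynomials are real and negative. -/
theorem IsPosStable.root_slice {d : ℕ} {p : MvPolynomial ι ℝ} (hp : IsPosStable d p)
    {x : ι → ℝ} (hx : ∀ i, 0 < x i) (k : ι) {r : ℂ}
    (hr : (slice p (fun i => (x i : ℂ)) k).eval r = 0) : ∃ ρ : ℝ, 0 < ρ ∧ r = -(ρ : ℂ) := by
  set ζ : ℂ := x k + r with hζ
  -- Off the half line `(-∞, 0]` the principal root `s = √ζ` has positive real part. Dividing the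
  -- point by `s` puts every coordinate in the right half plane (the `k`-th becomes `s`), and by
  -- homogeneity it is still a zero.
  have hζs : ζ ∉ Complex.slitPlane := by
    intro hs
    set s : ℂ := ζ ^ (1 / 2 : ℂ) with hs_def
    have hζ0 : ζ ≠ 0 := Complex.slitPlane_ne_zero hs
    have hss : s * s = ζ := by
      rw [hs_def, ← Complex.cpow_add _ _ hζ0]; norm_num
    have hsre : 0 < s.re := by
      have harg := (Complex.mem_slitPlane_iff_arg.mp hs).1
      have h1 := Complex.neg_pi_lt_arg ζ
      have h2 := lt_of_le_of_ne (Complex.arg_le_pi ζ) harg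
      rw [hs_def, Complex.cpow_def_of_ne_zero hζ0, Complex.exp_re]
      refine mul_pos (Real.exp_pos _) (Real.cos_pos_of_mem_Ioo ?_)
      have : (Complex.log ζ * (1 / 2)).im = ζ.arg / 2 := by
        rw [show (1 / 2 : ℂ) = ((1 / 2 : ℝ) : ℂ) by norm_num, Complex.im_mul_ofReal, Complex.log_im]
        ring
      rw [this]
      constructor <;> linarith
    have hs0 : s ≠ 0 := by rintro h; rw [h] at hsre; simp at hsre
    have hsinv : 0 < (s⁻¹).re := by
      rw [Complex.inv_re]; exact div_pos hsre (Complex.normSq_pos.mpr hs0)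
    rw [eval_slice] at hr
    refine hp.aeval_ne_zero (s⁻¹ • ((fun i => (x i : ℂ)) + r • Pi.single k 1)) (fun i => ?_) ?_
    · by_cases hi : i = k
      · subst hi
        have : s⁻¹ * ζ = s := by rw [← hss]; field_simp
        simpa [← hζ, this] using hsre
      · simpa [hi] using mul_pos hsinv (hx i)
    · rw [aeval_smul_of_isHomogeneous hp.isHomogeneous, hr, mul_zero]
  rw [Complex.mem_slitPlane_iff, not_or, not_lt, not_not] at hζs
  have him : r.im = 0 := by simpa [hζ] using hζs.2
  have hre : x k + r.re ≤ 0 := by simpa [hζ] using hζs.1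
  refine ⟨-r.re, by linarith [hx k], ?_⟩
  apply Complex.ext <;> simp [him]

/-- Factor by factor this is `t + ρ ≤ ρ e^(t/ρ)`. For the roots of a polynomial the exponent is `t`
times its logarithmic derivative at `0`. -/
theorem prod_one_add_le_exp (t : ℝ) (ht : 0 ≤ t) (s : Multiset ℂ)
    (hs : ∀ r ∈ s, ∃ ρ : ℝ, 0 < ρ ∧ r = -(ρ : ℂ)) :
    ‖(s.map fun r => (t : ℂ) - r).prod‖ ≤ ‖(s.map fun r => (0 : ℂ) - r).prod‖ *
      Real.exp (t * ((s.map fun r => 1 / (0 - r)).sum).re) := by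
  induction s using Multiset.induction_on with
  | empty => simp
  | cons r s ih =>
    obtain ⟨ρ, hρ, rfl⟩ := hs r (Multiset.mem_cons_self r s)
    have ih' := ih fun r hr => hs r (Multiset.mem_cons_of_mem hr)
    simp only [Multiset.map_cons, Multiset.prod_cons, Multiset.sum_cons, norm_mul, Complex.add_re,
      mul_add, Real.exp_add]
    have h1 : ‖(t : ℂ) - -(ρ : ℂ)‖ = t + ρ := by
      rw [sub_neg_eq_add, ← Complex.ofReal_add, Complex.norm_real, Real.norm_of_nonneg (by positivity)]
    have h2 : ‖(0 : ℂ) - -(ρ : ℂ)‖ = ρ := by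
      rw [sub_neg_eq_add, zero_add, Complex.norm_real, Real.norm_of_nonneg hρ.le]
    have h3 : (1 / ((0 : ℂ) - -(ρ : ℂ))).re = 1 / ρ := by
      rw [sub_neg_eq_add, zero_add, ← Complex.ofReal_one, ← Complex.ofReal_div, Complex.ofReal_re]
    rw [h1, h2, h3]
    have h4 : t + ρ ≤ ρ * Real.exp (t * (1 / ρ)) := by
      have := Real.add_one_le_exp (t * (1 / ρ))
      calc t + ρ = ρ * (t * (1 / ρ) + 1) := by field_simp
        _ ≤ _ := by gcongr
    calc _ ≤ (ρ * Real.exp (t * (1 / ρ))) * (‖(s.map fun r => (0 : ℂ) - r).prod‖ *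
          Real.exp (t * ((s.map fun r => 1 / (0 - r)).sum).re)) := by gcongr
      _ = _ := by ring

theorem IsPosStable.eval_add_single_le {d : ℕ} {p : MvPolynomial ι ℝ} (hp : IsPosStable d p)
    {x : ι → ℝ} (hx : ∀ i, 0 < x i) (k : ι) {t : ℝ} (ht : 0 ≤ t) :
    eval (x + t • Pi.single k 1) p ≤
      eval x p * Real.exp (t * (eval x (MvPolynomial.pderiv k p) / eval x p)) := by
  have : Nonempty ι := ⟨k⟩
  set R := slice p (fun i => (x i : ℂ)) k with hR
  have e0 : R.eval 0 = ((eval x p : ℝ) : ℂ) := by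
    rw [hR, eval_slice, zero_smul, add_zero, aeval_ofReal]
  have et : R.eval (t : ℂ) = ((eval (x + t • Pi.single k 1) p : ℝ) : ℂ) := by
    rw [hR, eval_slice, ← aeval_ofReal]
    congr 2; ext i
    by_cases hi : i = k
    · subst hi; simp
    · simp [hi]
  have ed : R.derivative.eval 0 = ((eval x (MvPolynomial.pderiv k p) : ℝ) : ℂ) := by
    rw [hR, derivative_slice, eval_slice, zero_smul, add_zero, aeval_ofReal]
  have hpos := hp.eval_pos hx
  have hne : R.eval 0 ≠ 0 := by rw [e0]; exact_mod_cast hpos.ne'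
  have hR0 : R ≠ 0 := by rintro h; rw [h] at hne; simp at hne
  have hs := IsAlgClosed.splits R
  have hroots : ∀ r ∈ R.roots, ∃ ρ : ℝ, 0 < ρ ∧ r = -(ρ : ℂ) := fun r hr =>
    hp.root_slice hx k ((Polynomial.mem_roots hR0).mp hr)
  have h1 := prod_one_add_le_exp t ht R.roots hroots
  have h2 := hs.eval_derivative_div_eval_of_ne_zero hne
  rw [← h2, ed, e0, ← Complex.ofReal_div, Complex.ofReal_re] at h1
  have h3 : ‖R.eval (t : ℂ)‖ ≤ ‖R.eval 0‖ *
      Real.exp (t * (eval x (MvPolynomial.pderiv k p) / eval x p)) := by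
    rw [hs.eval_eq_prod_roots, hs.eval_eq_prod_roots, norm_mul, norm_mul, mul_assoc]
    exact mul_le_mul_of_nonneg_left h1 (norm_nonneg _)
  rw [et, e0, Complex.norm_real, Complex.norm_real, Real.norm_of_nonneg hpos.le] at h3
  exact (le_abs_self _).trans h3

/-- Move by `t = p / ∂_k p` in direction `k`. The exponential bound gives at most `e p(x)`, while
the capacity hypothesis gives at least `c t ∏_T x_i`. Divide by `t`. -/
theorem IsPosStable.capacity_pderiv {d : ℕ} {p : MvPolynomial ι ℝ} (hp : IsPosStable (d + 1) p)
    {T : Finset ι} {k : ι} (hk : k ∉ T) {c : ℝ} (hc : 0 ≤ c)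
    (h : ∀ x : ι → ℝ, (∀ i, 0 < x i) → c * ∏ i ∈ insert k T, x i ≤ eval x p)
    {x : ι → ℝ} (hx : ∀ i, 0 < x i) :
    c * Real.exp (-1) * ∏ i ∈ T, x i ≤ eval x (MvPolynomial.pderiv k p) := by
  have : Nonempty ι := ⟨k⟩
  set A := eval x p with hA
  set B := eval x (MvPolynomial.pderiv k p) with hB
  have hApos : 0 < A := hp.eval_pos hx
  have hBpos : 0 < B := (hp.pderiv k).eval_pos hx
  set t := A / B with ht
  have htpos : 0 < t := div_pos hApos hBpos
  have h1 := hp.eval_add_single_le hx k htpos.le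
  have h2 : t * (B / A) = 1 := by rw [ht]; field_simp
  rw [← hA, ← hB, h2] at h1
  have hy : ∀ i, x i ≤ (x + t • Pi.single k 1 : ι → ℝ) i := by
    intro i
    by_cases hi : i = k
    · subst hi; simpa using htpos.le
    · simp [hi]
  have h3 := h (x + t • Pi.single k 1) fun i => (hx i).trans_le (hy i)
  rw [Finset.prod_insert hk] at h3
  have h4 : ∏ i ∈ T, (x + t • Pi.single k 1 : ι → ℝ) i = ∏ i ∈ T, x i := by
    refine Finset.prod_congr rfl fun i hi => ?_
    have : i ≠ k := by rintro rfl; exact hk hi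
    simp [this]
  have h5 : t ≤ (x + t • Pi.single k 1 : ι → ℝ) k := by simpa using (hx k).le
  rw [h4] at h3
  set Q := ∏ i ∈ T, x i with hQ
  have hQ0 : 0 ≤ Q := Finset.prod_nonneg fun i _ => (hx i).le
  have h6 : c * (t * Q) ≤ A * Real.exp 1 :=
    (by gcongr : c * (t * Q) ≤ c * ((x + t • Pi.single k 1 : ι → ℝ) k * Q)).trans (h3.trans h1)
  have h7 : A = t * B := by rw [ht]; field_simp
  rw [h7] at h6
  have h8 : c * Q ≤ B * Real.exp 1 := by
    refine le_of_mul_le_mul_left ?_ htpos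
    linarith
  rw [Real.exp_neg, mul_right_comm, ← div_eq_mul_inv, div_le_iff₀ (Real.exp_pos 1)]
  exact h8

/-- Differentiating once in each variable of `T` isolates the squarefree coefficient, at a cost of
`e` per derivative. -/
theorem IsPosStable.coeff_ge (T : Finset ι) : ∀ {p : MvPolynomial ι ℝ} {c : ℝ},
    IsPosStable T.card p → 0 ≤ c →
    (∀ x : ι → ℝ, (∀ i, 0 < x i) → c * ∏ i ∈ T, x i ≤ eval x p) →
    c * Real.exp (-(T.card : ℝ)) ≤ coeff (∑ i ∈ T, Finsupp.single i 1) p := by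
  induction T using Finset.induction_on with
  | empty =>
    intro p c hp hc h
    have h1 := h (fun _ => 1) fun _ => one_pos
    have h2 : p = C (coeff 0 p) := by
      rw [← totalDegree_eq_zero_iff_eq_C]
      exact Nat.le_zero.mp hp.isHomogeneous.totalDegree_le
    rw [h2, eval_C] at h1
    simpa using h1
  | insert k T hk ih =>
    intro p c hp hc h
    rw [Finset.card_insert_of_notMem hk] at hp
    have h1 := ih (hp.pderiv k) (c := c * Real.exp (-1)) (by positivity)
      fun x hx => hp.capacity_pderiv hk hc h hx
    rw [coeff_pderiv] at h1
    have h2 : (∑ i ∈ T, Finsupp.single i 1 : ι →₀ ℕ) k = 0 := by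
      rw [Finsupp.finsetSum_apply]
      refine Finset.sum_eq_zero fun i hi => ?_
      rw [Finsupp.single_eq_of_ne]
      rintro rfl; exact hk hi
    rw [h2, Nat.cast_zero, zero_add, mul_one, mul_assoc, ← Real.exp_add] at h1
    rw [Finset.card_insert_of_notMem hk, Finset.sum_insert hk, add_comm (Finsupp.single k 1)]
    convert h1 using 3
    push_cast; ring

end Stable

/-! ### A lower bound for permanents of doubly stochastic matrices. -/

section Permanent

open MvPolynomial

variable {n : ℕ}

theorem coeff_prod_linear_pos {a : Matrix (Fin n) (Fin n) ℝ} (ha : ∀ i j, 0 < a i j)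
    (s : Finset (Fin n)) : ∀ m : Fin n →₀ ℕ, ∑ i, m i = s.card →
      0 < coeff m (∏ i ∈ s, ∑ j, C (a i j) * (X j : MvPolynomial (Fin n) ℝ)) := by
  induction s using Finset.induction_on with
  | empty =>
    intro m hm
    have : m = 0 := by
      ext i
      exact (Finset.sum_eq_zero_iff.mp hm) i (Finset.mem_univ i)
    subst this
    simp
  | insert r s hr ih =>
    intro m hm
    rw [Finset.card_insert_of_notMem hr] at hm
    rw [Finset.prod_insert hr, Finset.sum_mul, coeff_sum]
    have hterm : ∀ j, coeff m (C (a r j) * (X j : MvPolynomial (Fin n) ℝ) *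
        ∏ i ∈ s, ∑ j, C (a i j) * X j) = a r j * if j ∈ m.support then
        coeff (m - Finsupp.single j 1) (∏ i ∈ s, ∑ j, C (a i j) * X j) else 0 := by
      intro j
      rw [mul_assoc, coeff_C_mul, coeff_X_mul']
    have hpos : ∀ j ∈ m.support,
        0 < coeff (m - Finsupp.single j 1)
          (∏ i ∈ s, ∑ j, C (a i j) * (X j : MvPolynomial (Fin n) ℝ)) := by
      intro j hj
      apply ih
      have h1 : m - Finsupp.single j 1 + Finsupp.single j 1 = m :=
        tsub_add_cancel_of_le (Finsupp.single_le_iff.mpr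
          (Nat.one_le_iff_ne_zero.mpr (Finsupp.mem_support_iff.mp hj)))
      have h2 : ∑ i, (m - Finsupp.single j 1 + Finsupp.single j 1 : Fin n →₀ ℕ) i = s.card + 1 := by
        rw [h1, hm]
      simp only [Finsupp.add_apply, Finset.sum_add_distrib] at h2
      have h3 : ∑ i, (Finsupp.single j 1 : Fin n →₀ ℕ) i = 1 := by simp
      omega
    obtain ⟨j, hj⟩ : ∃ j, j ∈ m.support := by
      by_contra! h
      have : ∑ i, m i = 0 := Finset.sum_eq_zero fun i _ => Finsupp.notMem_support_iff.mp (h i)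
      omega
    refine Finset.sum_pos' (fun i _ => ?_) ⟨j, Finset.mem_univ j, ?_⟩
    · rw [hterm]
      refine mul_nonneg (ha r i).le ?_
      split_ifs with hi
      · exact (hpos i hi).le
      · exact le_rfl
    · rw [hterm, if_pos hj]
      exact mul_pos (ha r j) (hpos j hj)

theorem isPosStable_prod_linear {a : Matrix (Fin n) (Fin n) ℝ} (ha : ∀ i j, 0 < a i j) :
    IsPosStable n (∏ i, ∑ j, C (a i j) * (X j : MvPolynomial (Fin n) ℝ)) where
  isHomogeneous := by
    have := IsHomogeneous.prod Finset.univ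
      (fun i => ∑ j, C (a i j) * (X j : MvPolynomial (Fin n) ℝ)) (fun _ => 1) fun i _ =>
        IsHomogeneous.sum _ _ _ fun j _ => isHomogeneous_C_mul_X _ _
    simpa using this
  coeff_pos m hm := coeff_prod_linear_pos ha _ m (by simpa using hm)
  aeval_ne_zero z hz := by
    rw [map_prod]
    refine Finset.prod_ne_zero_iff.mpr fun i _ h => ?_
    have h1 := congrArg Complex.re h
    simp only [map_sum, map_mul, aeval_C, aeval_X, Complex.re_sum, Complex.coe_algebraMap,
      Complex.re_ofReal_mul, Complex.zero_re] at h1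
    have h2 : 0 < ∑ j, a i j * (z j).re :=
      Finset.sum_pos (fun j _ => mul_pos (ha i j) (hz j)) ⟨i, Finset.mem_univ i⟩
    exact h2.ne' h1

theorem coeff_prod_linear (a : Matrix (Fin n) (Fin n) ℝ) :
    coeff (∑ i, Finsupp.single i 1)
      (∏ i, ∑ j, C (a i j) * (X j : MvPolynomial (Fin n) ℝ)) = a.permanent := by
  rw [Finset.prod_univ_sum, coeff_sum]
  have h1 : ∀ f : Fin n → Fin n, coeff (∑ i, Finsupp.single i 1)
      (∏ i, C (a i (f i)) * (X (f i) : MvPolynomial (Fin n) ℝ)) =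
      if Function.Bijective f then ∏ i, a i (f i) else 0 := by
    intro f
    have h2 : (∏ i, C (a i (f i)) * (X (f i) : MvPolynomial (Fin n) ℝ)) =
        C (∏ i, a i (f i)) * monomial (∑ i, Finsupp.single (f i) 1) 1 := by
      rw [Finset.prod_mul_distrib, map_prod, monomial_sum_one]
      rfl
    rw [h2, coeff_C_mul, coeff_monomial]
    have h3 : (∑ i, Finsupp.single (f i) 1 = (∑ i, Finsupp.single i 1 : Fin n →₀ ℕ)) ↔
        Function.Bijective f := by
      constructor
      · intro h
        apply Finite.surjective_iff_bijective.mp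
        intro j
        by_contra! hj
        have h4 := DFunLike.congr_fun h j
        rw [Finsupp.finsetSum_apply, Finsupp.finsetSum_apply, Finset.sum_eq_zero,
          Finset.sum_eq_single j] at h4
        · simp at h4
        · intro i _ hi
          exact Finsupp.single_eq_of_ne hi.symm
        · simp
        · intro i _
          exact Finsupp.single_eq_of_ne (hj i).symm
      · intro h
        exact h.sum_comp fun i => Finsupp.single i 1
    simp only [h3, mul_ite, mul_one, mul_zero]
  rw [Finset.sum_congr rfl fun f _ => h1 f, ← Finset.sum_filter, ← Matrix.permanent_transpose,
    Matrix.permanent]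
  symm
  refine Finset.sum_nbij (fun σ => ⇑σ) ?_ ?_ ?_ fun _ _ => rfl
  · exact fun σ _ => Finset.mem_filter.mpr ⟨by simp, σ.bijective⟩
  · exact fun σ _ τ _ h => DFunLike.coe_injective h
  · intro f hf
    exact ⟨Equiv.ofBijective f (Finset.mem_filter.mp hf).2, by simp, rfl⟩

/-- The product of row forms has capacity at least `1`: weighted AM-GM in each row, after which the
exponent of `x_j` is a column sum, equal to `1`. -/
theorem prod_le_prod_sum_of_doublyStochastic {a : Matrix (Fin n) (Fin n) ℝ}
    (ha : a ∈ doublyStochastic ℝ (Fin n)) {x : Fin n → ℝ} (hx : ∀ i, 0 < x i) :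
    ∏ i, x i ≤ ∏ i, ∑ j, a i j * x j := by
  have h1 : ∀ i, ∏ j, x j ^ a i j ≤ ∑ j, a i j * x j := fun i =>
    Real.geom_mean_le_arith_mean_weighted Finset.univ (fun j => a i j) x
      (fun j _ => nonneg_of_mem_doublyStochastic ha) (sum_row_of_mem_doublyStochastic ha i)
      fun j _ => (hx j).le
  calc ∏ j, x j = ∏ i, ∏ j, x j ^ a i j := by
        rw [Finset.prod_comm]
        refine Finset.prod_congr rfl fun j _ => ?_
        rw [← Real.rpow_sum_of_pos (hx j), sum_col_of_mem_doublyStochastic ha, Real.rpow_one]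
    _ ≤ _ := Finset.prod_le_prod
        (fun i _ => Finset.prod_nonneg fun j _ => Real.rpow_nonneg (hx j).le _) fun i _ => h1 i

/-- A weak form of the van der Waerden bound: the permanent of a doubly stochastic matrix of order
`n` is at least `e ^ (-n)`. -/
theorem exp_neg_le_permanent {a : Matrix (Fin n) (Fin n) ℝ}
    (ha : a ∈ doublyStochastic ℝ (Fin n)) : Real.exp (-(n : ℝ)) ≤ a.permanent := by
  -- Adding `δ` makes all coefficients strictly positive, as `IsPosStable` demands, and only
  -- increases the product of row forms; then `δ → 0`.
  have h1 : ∀ δ : ℝ, 0 < δ → Real.exp (-(n : ℝ)) ≤ (Matrix.of fun i j => a i j + δ).permanent := by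
    intro δ hδ
    set b : Matrix (Fin n) (Fin n) ℝ := Matrix.of fun i j => a i j + δ with hb
    have hbpos : ∀ i j, 0 < b i j := fun i j =>
      add_pos_of_nonneg_of_pos (nonneg_of_mem_doublyStochastic ha) hδ
    have h2 := IsPosStable.coeff_ge (Finset.univ : Finset (Fin n)) (c := 1)
      (by simpa using isPosStable_prod_linear hbpos) zero_le_one fun x hx => by
        rw [one_mul, map_prod]
        refine (prod_le_prod_sum_of_doublyStochastic ha hx).trans ?_
        simp only [map_sum, map_mul, eval_C, eval_X]
        refine Finset.prod_le_prod (fun i _ => Finset.sum_nonneg fun j _ =>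
          mul_nonneg (nonneg_of_mem_doublyStochastic ha) (hx j).le) fun i _ =>
            Finset.sum_le_sum fun j _ => mul_le_mul_of_nonneg_right ?_ (hx j).le
        simp [hb, hδ.le]
    rw [coeff_prod_linear, one_mul, Finset.card_univ, Fintype.card_fin] at h2
    exact h2
  have h2 : Tendsto (fun δ : ℝ => (Matrix.of fun i j => a i j + δ).permanent) (𝓝[>] 0)
      (𝓝 a.permanent) := by
    have hc : Continuous fun δ : ℝ => (Matrix.of fun i j => a i j + δ).permanent := by
      unfold Matrix.permanent
      simp only [Matrix.of_apply]
      fun_prop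
    have := hc.tendsto 0
    simp only [add_zero] at this
    exact this.mono_left nhdsWithin_le_nhds
  exact ge_of_tendsto h2 (by filter_upwards [self_mem_nhdsWithin] with δ hδ using h1 δ hδ)

end Permanent

/-! ### Counting Latin rectangles row by row. -/

section Rectangles

variable {n : ℕ}

/-- The `k × n` Latin rectangles, as `k`-tuples of permutations disagreeing everywhere. -/
def latinRectangles (n k : ℕ) : Finset (Fin k → Equiv.Perm (Fin n)) :=
  {f | ∀ i i' j, f i j = f i' j → i = i'}

theorem mem_latinRectangles {k : ℕ} {f : Fin k → Equiv.Perm (Fin n)} :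
    f ∈ latinRectangles n k ↔ ∀ i i' j, f i j = f i' j → i = i' := by
  simp [latinRectangles]

/-- The rows by which a Latin rectangle can be extended. -/
def extensionRows {k : ℕ} (f : Fin k → Equiv.Perm (Fin n)) : Finset (Equiv.Perm (Fin n)) :=
  {ρ | ∀ i j, f i j ≠ ρ j}

/-- The `0`-`1` matrix of symbols still allowed in each column. -/
def freeMatrix {k : ℕ} (f : Fin k → Equiv.Perm (Fin n)) : Matrix (Fin n) (Fin n) ℝ :=
  Matrix.of fun s j => if ∀ i, f i j ≠ s then 1 else 0

theorem permanent_freeMatrix {k : ℕ} (f : Fin k → Equiv.Perm (Fin n)) :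
    (freeMatrix f).permanent = (extensionRows f).card := by
  rw [Matrix.permanent, extensionRows, Finset.card_filter, Nat.cast_sum]
  refine Finset.sum_congr rfl fun ρ _ => ?_
  simp only [freeMatrix, Matrix.of_apply]
  by_cases h : ∀ i j, f i j ≠ ρ j
  · rw [if_pos h, Finset.prod_eq_one fun j _ => if_pos fun i => h i j, Nat.cast_one]
  · rw [if_neg h, Nat.cast_zero]
    push Not at h
    obtain ⟨i, j, hij⟩ := h
    exact Finset.prod_eq_zero (Finset.mem_univ j) (if_neg fun h' => h' i hij)

theorem card_filter_forall_ne {k : ℕ} {g : Fin k → Fin n} (hg : Function.Injective g) :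
    ((Finset.univ.filter fun s => ∀ i, g i ≠ s).card : ℕ) = n - k := by
  have h1 : (Finset.univ.filter fun s => ∀ i, g i ≠ s) = (Finset.univ.image g)ᶜ := by
    ext s; simp
  rw [h1, Finset.card_compl, Finset.card_image_of_injective _ hg]
  simp

/-- Each column has used `k` distinct symbols, and each symbol has occupied `k` distinct columns, so
every row and column sum of the free matrix is `n - k`. -/
theorem smul_freeMatrix_mem_doublyStochastic {k : ℕ} (hk : k < n)
    {f : Fin k → Equiv.Perm (Fin n)} (hf : f ∈ latinRectangles n k) :
    ((n - k : ℕ) : ℝ)⁻¹ • freeMatrix f ∈ doublyStochastic ℝ (Fin n) := by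
  rw [mem_latinRectangles] at hf
  have hnk : ((n - k : ℕ) : ℝ) ≠ 0 := Nat.cast_ne_zero.mpr (by omega)
  have hcol : ∀ j, ∑ s, freeMatrix f s j = ((n - k : ℕ) : ℝ) := by
    intro j
    simp only [freeMatrix, Matrix.of_apply]
    rw [Finset.sum_boole, card_filter_forall_ne fun i i' h => hf i i' j h]
  have hrow : ∀ s, ∑ j, freeMatrix f s j = ((n - k : ℕ) : ℝ) := by
    intro s
    simp only [freeMatrix, Matrix.of_apply]
    rw [Finset.sum_boole, ← card_filter_forall_ne (g := fun i => (f i).symm s)]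
    · congr 2
      ext j
      simp only [Finset.mem_filter, Finset.mem_univ, true_and]
      refine forall_congr' fun i => not_congr ?_
      rw [Equiv.symm_apply_eq, eq_comm]
    · intro i i' h
      refine hf i i' ((f i).symm s) ?_
      simp only at h
      conv_rhs => rw [h]
      simp
  rw [mem_doublyStochastic_iff_sum]
  refine ⟨fun s j => ?_, fun s => ?_, fun j => ?_⟩
  · simp only [Matrix.smul_apply, freeMatrix, Matrix.of_apply, smul_eq_mul]
    positivity
  · simp only [Matrix.smul_apply, smul_eq_mul]
    rw [← Finset.mul_sum, hrow, inv_mul_cancel₀ hnk]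
  · simp only [Matrix.smul_apply, smul_eq_mul]
    rw [← Finset.mul_sum, hcol, inv_mul_cancel₀ hnk]

theorem le_card_extensionRows {k : ℕ} (hk : k < n)
    {f : Fin k → Equiv.Perm (Fin n)} (hf : f ∈ latinRectangles n k) :
    ((n - k : ℕ) : ℝ) ^ n * Real.exp (-(n : ℝ)) ≤ (extensionRows f).card := by
  have hnk : (0 : ℝ) < ((n - k : ℕ) : ℝ) := Nat.cast_pos.mpr (by omega)
  have h := exp_neg_le_permanent (smul_freeMatrix_mem_doublyStochastic hk hf)
  rw [Matrix.permanent_smul, permanent_freeMatrix, Fintype.card_fin, inv_pow] at h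
  rwa [← div_eq_inv_mul, le_div_iff₀ (by positivity), mul_comm] at h

theorem mul_card_latinRectangles_le {k : ℕ} (hk : k < n) :
    ((n - k : ℕ) : ℝ) ^ n * Real.exp (-(n : ℝ)) * (latinRectangles n k).card ≤
      (latinRectangles n (k + 1)).card := by
  have h1 : ((latinRectangles n k).sigma fun f => extensionRows f).card ≤
      (latinRectangles n (k + 1)).card := by
    refine Finset.card_le_card_of_injOn
      (fun x => (Fin.cons x.2 x.1 : Fin (k + 1) → Equiv.Perm (Fin n))) ?_ ?_
    · rintro ⟨f, ρ⟩ hx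
      simp only [Finset.coe_sigma, Set.mem_sigma_iff, Finset.mem_coe, mem_latinRectangles,
        extensionRows, Finset.mem_filter, Finset.mem_univ, true_and] at hx ⊢
      intro i i' j h
      cases i using Fin.cases with
      | zero =>
        cases i' using Fin.cases with
        | zero => rfl
        | succ i' =>
          simp only [Fin.cons_zero, Fin.cons_succ] at h
          exact absurd h.symm (hx.2 i' j)
      | succ i =>
        cases i' using Fin.cases with
        | zero =>
          simp only [Fin.cons_zero, Fin.cons_succ] at h
          exact absurd h (hx.2 i j)
        | succ i' =>
          simp only [Fin.cons_succ] at h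
          rw [hx.1 i i' j h]
    · rintro ⟨f, ρ⟩ _ ⟨f', ρ'⟩ _ h
      obtain ⟨rfl, rfl⟩ := Fin.cons_injective2 h
      rfl
  rw [Finset.card_sigma] at h1
  calc _ = ∑ f ∈ latinRectangles n k, ((n - k : ℕ) : ℝ) ^ n * Real.exp (-(n : ℝ)) := by
        rw [Finset.sum_const, nsmul_eq_mul, mul_comm]
    _ ≤ ∑ f ∈ latinRectangles n k, ((extensionRows f).card : ℝ) :=
        Finset.sum_le_sum fun f hf => le_card_extensionRows hk hf
    _ ≤ _ := by exact_mod_cast h1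

theorem prod_le_card_latinRectangles {k : ℕ} (hk : k ≤ n) :
    ∏ i ∈ Finset.range k, (((n - i : ℕ) : ℝ) ^ n * Real.exp (-(n : ℝ))) ≤
      (latinRectangles n k).card := by
  induction k with
  | zero =>
    rw [Finset.prod_range_zero, Nat.one_le_cast, Nat.one_le_iff_ne_zero, Finset.card_ne_zero]
    exact ⟨Fin.elim0, mem_latinRectangles.mpr fun i => i.elim0⟩
  | succ k ih =>
    rw [Finset.prod_range_succ, mul_comm]
    refine le_trans ?_ (mul_card_latinRectangles_le (by omega : k < n))
    exact mul_le_mul_of_nonneg_left (ih (by omega)) (by positivity)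

theorem card_latinRectangles_le_latinCount : (latinRectangles n n).card ≤ latinCount n := by
  rw [latinCount, Nat.card_eq_fintype_card, ← Fintype.card_coe]
  refine Fintype.card_le_of_injective (fun f : latinRectangles n n =>
    (⟨fun i j => f.1 i j, fun i => (f.1 i).bijective, fun j =>
      Finite.injective_iff_bijective.mp fun i i' h =>
        mem_latinRectangles.mp f.2 i i' j h⟩ : LatinSquare n)) ?_
  intro f f' h
  apply Subtype.ext
  ext1 i
  ext1 j
  exact congrFun (congrFun (congrArg Subtype.val h) i) j

/-- The number of Latin squares of order `n` is at least `(n / e²) ^ (n²)`. -/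
theorem le_latinCount (n : ℕ) :
    (n : ℝ) ^ (n ^ 2) * Real.exp (-(2 * (n : ℝ) ^ 2)) ≤ latinCount n := by
  have h1 := prod_le_card_latinRectangles (le_refl n)
  have h2 : ((latinRectangles n n).card : ℝ) ≤ latinCount n :=
    Nat.cast_le.mpr card_latinRectangles_le_latinCount
  refine le_trans ?_ (h1.trans h2)
  rw [Finset.prod_mul_distrib, Finset.prod_pow, Finset.prod_const, Finset.card_range,
    ← Nat.cast_prod, ← Nat.descFactorial_eq_prod_range, Nat.descFactorial_self, ← Real.exp_nat_mul]
  -- The product over rows is `(n!)^n e^(-n²)`; this bound on `n!` supplies the second factor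
  -- `e^(-n²)`.
  have h3 : (n : ℝ) ^ n * Real.exp (-(n : ℝ)) ≤ n ! := by
    have := Real.pow_div_factorial_le_exp (n : ℝ) (Nat.cast_nonneg n) n
    rw [div_le_iff₀ (by positivity)] at this
    rw [Real.exp_neg, ← div_eq_mul_inv, div_le_iff₀ (Real.exp_pos _), mul_comm]
    exact this
  calc _ = ((n : ℝ) ^ n * Real.exp (-(n : ℝ))) ^ n * Real.exp (n * -(n : ℝ)) := by
        rw [mul_pow, ← pow_mul, ← sq, ← Real.exp_nat_mul, mul_assoc, ← Real.exp_add]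
        ring_nf
    _ ≤ _ := by gcongr

end Rectangles

/-! ### Asymptotics of the constant and the final estimate. -/

section Asymptotics

theorem inv_succ_le_log_sub_log {m : ℕ} (hm : 1 ≤ m) :
    1 / ((m : ℝ) + 1) ≤ Real.log (m + 1) - Real.log m := by
  have hm' : (0 : ℝ) < m := Nat.cast_pos.mpr hm
  rw [← Real.log_div (by positivity) hm'.ne']
  refine le_trans (le_of_eq ?_) (Real.one_sub_inv_le_log_of_pos (by positivity))
  field_simp
  ring

theorem log_factorial_le {m : ℕ} (hm : 1 ≤ m) :
    Real.log (m ! : ℝ) ≤ 1 + Real.log m + m * Real.log m - m := by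
  induction m, hm using Nat.le_induction with
  | base => simp
  | succ m hm ih =>
    have hm' : (0 : ℝ) < m := Nat.cast_pos.mpr hm
    have h1 := inv_succ_le_log_sub_log hm
    rw [div_le_iff₀ (by positivity)] at h1
    rw [Nat.factorial_succ, Nat.cast_mul, Real.log_mul (by positivity) (by positivity)]
    push_cast
    nlinarith

theorem le_log_factorial {m : ℕ} (hm : 1 ≤ m) : m * Real.log m - m ≤ Real.log (m ! : ℝ) := by
  have hm' : (0 : ℝ) < m := Nat.cast_pos.mpr hm
  have := Real.pow_div_factorial_le_exp (m : ℝ) hm'.le m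
  have h2 := Real.log_le_log (by positivity) this
  rw [Real.log_exp, Real.log_div (by positivity) (by positivity), Real.log_pow] at h2
  linarith

/-- The constant `∏_{m < n} (n + m)! / m!`. -/
noncomputable def superRatio (n : ℕ) : ℝ := ∏ m ∈ Finset.range n, ((n + m)! : ℝ) / (m ! : ℝ)

theorem superRatio_pos (n : ℕ) : 0 < superRatio n :=
  Finset.prod_pos fun m _ => by positivity

theorem superRatio_succ (n : ℕ) :
    superRatio (n + 1) = superRatio n * ((2 * n + 1) * ((2 * n)! / n ! : ℝ) ^ 2) := by
  have h1 : (∏ m ∈ Finset.range (n + 1), ((n + 1 + m)! : ℝ)) * (n ! : ℝ) =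
      (∏ m ∈ Finset.range n, ((n + m)! : ℝ)) * ((2 * n)! * (2 * n + 1)! : ℝ) := by
    have h2 := Finset.prod_range_succ' (fun m => ((n + m)! : ℝ)) (n + 1)
    rw [Finset.prod_range_succ, Finset.prod_range_succ] at h2
    rw [← add_assoc, ← two_mul, add_zero] at h2
    rw [← mul_assoc, h2]
    congr 1
    exact Finset.prod_congr rfl fun m _ => by rw [show n + (m + 1) = n + 1 + m by ring]
  have h4 : ∏ m ∈ Finset.range n, (m ! : ℝ) ≠ 0 :=
    Finset.prod_ne_zero_iff.mpr fun m _ => by positivity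
  have h5 : (n ! : ℝ) ≠ 0 := by positivity
  unfold superRatio
  rw [Finset.prod_div_distrib, Finset.prod_div_distrib, Finset.prod_range_succ (fun m => (m ! : ℝ)),
    eq_div_of_mul_eq h5 h1, Nat.factorial_succ (2 * n)]
  push_cast
  field_simp

/-- Induction through the ratio of consecutive terms. By the factorial bounds the logarithm of the
ratio is at most `2n log n + (4 log 2 - 2) n` up to logarithmic terms, which matches the growth of
the quadratic term; the linear-times-log term absorbs the rest. -/
theorem log_superRatio_le {n : ℕ} (hn : 1 ≤ n) :
    Real.log (superRatio n) ≤ (n : ℝ) ^ 2 * (Real.log n + 2 * Real.log 2 - 3 / 2) +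
      n * (6 + 3 * Real.log (n + 1)) := by
  have hl2 := Real.log_two_gt_d9
  have hl2' := Real.log_two_lt_d9
  induction n, hn using Nat.le_induction with
  | base =>
    norm_num [superRatio]
    nlinarith
  | succ n hn ih =>
    have hn' : (1 : ℝ) ≤ n := Nat.one_le_cast.mpr hn
    rw [superRatio_succ, Real.log_mul (superRatio_pos n).ne' (by positivity),
      Real.log_mul (by positivity) (by positivity), Real.log_pow,
      Real.log_div (by positivity) (by positivity)]
    have h1 := log_factorial_le (m := 2 * n) (by omega)
    have h2 := le_log_factorial hn
    have h3 := inv_succ_le_log_sub_log hn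
    push_cast at h1 ⊢
    rw [Real.log_mul two_ne_zero (by positivity)] at h1
    rw [div_le_iff₀ (by positivity)] at h3
    have h4 : Real.log (2 * n + 1) ≤ Real.log 2 + Real.log (n + 1) := by
      rw [← Real.log_mul two_ne_zero (by positivity)]
      exact Real.log_le_log (by positivity) (by linarith)
    have h5 : Real.log ((n : ℝ) + 1) ≤ Real.log (n + 1 + 1) :=
      Real.log_le_log (by positivity) (by linarith)
    have h6 : 0 ≤ Real.log (n : ℝ) := Real.log_nonneg hn'
    set a := Real.log (n : ℝ)
    set b := Real.log ((n : ℝ) + 1)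
    set c := Real.log ((n : ℝ) + 1 + 1)
    set x := (n : ℝ)
    have h7 : 0 ≤ b - a := by
      by_contra! h
      nlinarith
    -- This linear gain in the increment of `x² log x` is what turns the slope `-3` coming from
    -- `-3/2 x²` into the required `-2`.
    have h8 : x - 1 ≤ x ^ 2 * (b - a) := by
      have : x - 1 ≤ x * (x * (b - a)) := by
        have h9 : 1 - (b - a) ≤ x * (b - a) := by linarith
        have h10 : x - x * (b - a) ≤ x * (x * (b - a)) := by nlinarith
        have h11 : x * (b - a) ≤ 1 := by
          have := Real.log_le_sub_one_of_pos (x := ((n : ℝ) + 1) / n) (by positivity)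
          rw [Real.log_div (by positivity) (by positivity)] at this
          have h12 : ((n : ℝ) + 1) / n - 1 = 1 / n := by field_simp; ring
          rw [h12, le_div_iff₀ (by positivity)] at this
          linarith
        linarith
      linarith
    have h13 : x * b ≤ x * c := mul_le_mul_of_nonneg_left h5 (by linarith)
    have h14 : x * a ≤ x * b := mul_le_mul_of_nonneg_left (by linarith) (by linarith)
    nlinarith

theorem log_base_eq : Real.log (4 / √(Real.exp 1)) = 2 * Real.log 2 - 1 / 2 := by
  rw [Real.log_div (by norm_num) (by positivity), Real.log_sqrt (Real.exp_pos 1).le, Real.log_exp,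
    show (4 : ℝ) = 2 ^ 2 by norm_num, Real.log_pow]
  norm_num

/-- After squaring, the bound is `R² n^(-n²)`, with leading part `exp(n² log n + n²(4 log 2 - 3))`.
The factor `exp(n² log n - 2n²)` is at most `L(n)`, which leaves `n²(4 log 2 - 1)`. -/
theorem abs_evenLatinCount_sub_oddLatinCount_le (n : ℕ) (hn : 1 ≤ n) :
    |(evenLatinCount n : ℝ) - oddLatinCount n| ≤ (latinCount n : ℝ) ^ (1 / 2 : ℝ) *
      Real.exp ((n : ℝ) ^ 2 * (2 * Real.log 2 - 1 / 2) + n * (6 + 3 * Real.log (n + 1))) := by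
  have hn' : (0 : ℝ) < n := Nat.cast_pos.mpr hn
  set E := (n : ℝ) * (6 + 3 * Real.log (n + 1))
  have h1 := evenLatinCount_sub_oddLatinCount_sq_mul_le (n := n)
  have h2 := le_latinCount n
  have h3 : superRatio n ≤
      Real.exp ((n : ℝ) ^ 2 * (Real.log n + 2 * Real.log 2 - 3 / 2) + E) :=
    (Real.log_le_iff_le_exp (superRatio_pos n)).mp (log_superRatio_le hn)
  have h4 : (n : ℝ) ^ (n ^ 2) = Real.exp ((n : ℝ) ^ 2 * Real.log n) := by
    rw [← Real.rpow_natCast, Real.rpow_def_of_pos hn', mul_comm]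
    push_cast; rfl
  rw [← sq_le_sq₀ (abs_nonneg _) (by positivity), sq_abs, mul_pow, ← Real.sqrt_eq_rpow,
    Real.sq_sqrt (Nat.cast_nonneg _)]
  change _ ≤ superRatio n ^ 2 at h1
  have h5 := h1.trans (pow_le_pow_left₀ (superRatio_pos n).le h3 2)
  rw [h4] at h2 h5
  rw [← le_div_iff₀ (Real.exp_pos _), ← Real.exp_nat_mul, ← Real.exp_sub] at h5
  refine h5.trans (le_trans (le_of_eq ?_)
    (mul_le_mul_of_nonneg_right h2 (sq_nonneg _)))
  rw [← Real.exp_nat_mul, ← Real.exp_add, ← Real.exp_add]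
  congr 1
  push_cast
  ring

end Asymptotics

end LatinParity

theorem corollary5 :
    (∀ (n k : ℕ) (α : Fin n × Fin n →₀ ℕ), (∑ i, ∑ j, α (i, j)) = k * n →
      (LatinParity.detPowCoeff n k α : ℂ) * ∏ i, ∏ j, ((α (i, j))! : ℂ) =
        (∏ m ∈ Finset.range n, ((k + m)! : ℂ)) / (∏ m ∈ Finset.range n, (m ! : ℂ)) *
          ∫ U : LatinParity.SU n, ∏ i, ∏ j, U.1 i j ^ α (i, j) ∂(LatinParity.haarSU n)) ∧
    (∃ ε : ℕ → ℝ, Tendsto ε atTop (𝓝 0) ∧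
      ∀ n : ℕ, |(LatinParity.evenLatinCount n : ℝ) - (LatinParity.oddLatinCount n : ℝ)| ≤
        (LatinParity.latinCount n : ℝ) ^ (1 / 2 : ℝ) *
          (4 / √(Real.exp 1)) ^ ((n : ℝ) ^ 2 * (1 + ε n))) := by
  refine ⟨LatinParity.detPowCoeff_mul_factorial, ?_⟩
  have hl2 := Real.log_two_gt_d9
  set b : ℝ := 2 * Real.log 2 - 1 / 2 with hb
  have hbpos : 0 < b := by linarith
  -- Dividing the error `n (6 + 3 log (n+1))` by `b n²` gives the order of `ε`; the factor `2` pays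
  -- for the denominator `n + 1` in place of `n`.
  refine ⟨fun n => 2 / b * ((6 + 3 * Real.log (n + 1)) / (n + 1)), ?_, fun n => ?_⟩
  · have h1 : Tendsto (fun n : ℕ => (n : ℝ) + 1) atTop atTop :=
      tendsto_atTop_add_const_right _ _ tendsto_natCast_atTop_atTop
    have h2 := (Real.isLittleO_log_id_atTop.tendsto_div_nhds_zero.comp h1).const_mul 3
    have h3 := (tendsto_inv_atTop_zero.comp h1).const_mul (6 : ℝ)
    have h4 := (h3.add h2).const_mul (2 / b)
    simp only [mul_zero, add_zero] at h4
    refine h4.congr fun n => ?_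
    simp only [Function.comp, id]
    ring
  rcases Nat.eq_zero_or_pos n with rfl | hn
  -- In order `0` the exponent vanishes; the difference is at most `1` in absolute value, and `L(0)
  -- ≥ 1`.
  · have h1 := LatinParity.evenLatinCount_sub_oddLatinCount_sq_mul_le (n := 0)
    have h2 := LatinParity.le_latinCount 0
    norm_num at h1 h2 ⊢
    rw [← Real.sqrt_eq_rpow]
    exact h1.trans (Real.one_le_sqrt.mpr (by exact_mod_cast h2))
  · refine (LatinParity.abs_evenLatinCount_sub_oddLatinCount_le n hn).trans ?_
    have hn' : (1 : ℝ) ≤ n := Nat.one_le_cast.mpr hn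
    rw [Real.rpow_def_of_pos (by positivity : 0 < 4 / √(Real.exp 1)), LatinParity.log_base_eq,
      ← hb]
    refine mul_le_mul_of_nonneg_left (Real.exp_le_exp.mpr ?_) (by positivity)
    have hlog : 0 ≤ Real.log ((n : ℝ) + 1) := Real.log_nonneg (by linarith)
    set E := 6 + 3 * Real.log ((n : ℝ) + 1) with hE
    have hE0 : 0 ≤ E := by positivity
    -- This is `n + 1 ≤ 2n`.
    have h1 : (n : ℝ) * E ≤ (n : ℝ) ^ 2 * (2 * (E / (n + 1))) := by
      rw [mul_div_assoc', mul_div_assoc', le_div_iff₀ (by positivity)]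
      nlinarith [mul_nonneg (mul_nonneg (by linarith : (0 : ℝ) ≤ n) hE0)
        (by linarith : (0 : ℝ) ≤ (n : ℝ) - 1)]
    have h2 : b * ((n : ℝ) ^ 2 * (1 + 2 / b * (E / (n + 1)))) =
        (n : ℝ) ^ 2 * b + (n : ℝ) ^ 2 * (2 * (E / (n + 1))) := by
      field_simp
    rw [h2]
    linarith
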